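/- Let $\mathcal S,\mathcal A$ be finite sets, $P$ a transition kernel on $\mathcal S$ given $\mathcal S\times\mathcal A$, $\rho$ an initial distribution on $\mathcal S$, $\gamma\in(0,1)$, $r_1,\dots,r_m:\mathcal S\times\mathcal A\to[0,1]$ reward functions ($m\ge1$) and $b_2,\dots,b_m\in[0,\frac1{1-\gamma}]$. For a stationary policy $\pi:\mathcal S\to\Delta(\mathcal A)$ and $r:\mathcal S\times\mathcal A\to\mathbb R$ let $V^\pi_r(\rho)=\mathbb E_{s_0\sim\rho}\big[\sum_{t\ge0}\gamma^t r(s_t,a_t)\mid\pi\big]$ and $V_i^\pi=V^\pi_{r_i}(\rho)$; let $d^\pi_\rho(s,a)=(1-\gamma)\sum_{t\ge 0}\gamma^t\,\mathbb P(s_t=s,a_t=a\mid s_0\sim\rho,\pi)$, with state marginal $d^\pi_\rho(s)$, and $D_{d}(\pi\|\pi')=\sum_s d(s)\sum_a\pi(a|s)\log\frac{\pi(a|s)}{\pi'(a|s)}$. Consider the constrained MDP $$\max_\pi V_1^\pi\quad\text{subject to}\quad V_i^\pi\ge b_i,\ i=2,\dots,m.$$ Let $\pi^*$ be an optimal policy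 of it, let $\mathcal L(\pi,\lambda)=V_1^\pi+\sum_{i=2}^m\lambda_i(V_i^\pi-b_i)$, and let $\lambda^*\in[0,\infty)^{m-1}$ be a (finite) minimizer of the dual function $\lambda\mapsto\max_\pi\mathcal L(\pi,\lambda)$ over $\lambda\ge0$. Policies are parameterized by softmax, $\pi_\theta(a|s)=e^{\theta_{s,a}}/\sum_{a'}e^{\theta_{s,a'}}$, $\theta\in\mathbb R^{\mathcal S\times\mathcal A}$. For a reward $\tilde r$, an anchor parameter $\bar\theta$ and $\alpha,\eta>0$, $t\in\mathbb N$, let $\mathrm{InnerLoop}(\tilde r,\bar\theta,\alpha,\eta,t)$ be the parameter $\theta^{(t)}$ obtained from $\theta^{(0)}=\bar\theta$ by the natural policy gradient steps $$\theta^{(j+1)}=\theta^{(j)}+\eta\,\mathcal F_\rho(\theta^{(j)})^{\dagger}\,\nabla_\theta\Big[V^{\pi_\theta}_{\tilde r}(\rho)-\tfrac{\alpha}{1-\gamma}D_{d^{\pi_\theta}_\rho}(\pi_\theta\|\pi_{\bar\theta})\Big]_{\theta=\theta^{(j)}},$$ where $\mathcal F_\rho(\theta)=\mathbb E_{(s,a)\sim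 d^{\pi_\theta}_\rho}[\nabla_\theta\log\pi_\theta(a|s)\nabla_\theta\log\pi_\theta(a|s)^\top]$ and $\dagger$ is the Moore-Penrose inverse. The algorithm ARNPG-EPD with inputs $\pi_0=\pi_{\theta_0},\eta',\alpha,\eta,t_0,\dots,t_{K-1}$ starts from $\lambda_{0,i}=\max\{\eta'(V_i^{\pi_0}-b_i),0\}$ and for $k=0,\dots,K-1$ sets $\tilde r_k=r_1+\sum_{i=2}^m\big(\lambda_{k,i}+\eta'(b_i-V_i^{\pi_k})\big)r_i$, $\theta_{k+1}=\mathrm{InnerLoop}(\tilde r_k,\theta_k,\alpha,\eta,t_k)$, $\pi_{k+1}=\pi_{\theta_{k+1}}$, and $$\lambda_{k+1,i}=\max\big\{\eta'(V_i^{\pi_{k+1}}-b_i),\ \lambda_{k,i}+\eta'(b_i-V_i^{\pi_{k+1}})\big\},\quad i=2,\dots,m.$$ Theorem. For any $K\ge1$ and $\eta'\in(0,1]$, take the uniform policy $\pi_0$, $\alpha\ge\frac{2\eta' m}{(1-\gamma)^3}$, $\eta=\frac{1-\gamma}\alpha$, and $t_k=\Big\lceil\frac1{1-\gamma}\log\Big(\frac{5L_kK}{2\eta'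 m\log|\mathcal A|}\Big)+1\Big\rceil$ (read as $0$ if negative) with $L_k=1+\frac{\eta'(m-1)}{1-\gamma}+\sum_{i=2}^m\lambda_{k,i}$. Then $$V_1^{\pi^*}-\frac1K\sum_{k=1}^K V_1^{\pi_k}\le\frac{3\alpha\log|\mathcal A|}{(1-\gamma)K},$$ $$b_i-\frac1K\sum_{k=1}^K V_i^{\pi_k}\le\frac1K\left(\frac{2\|\lambda^*\|_2}{\eta'}+3\sqrt{\frac{\alpha\log|\mathcal A|}{(1-\gamma)\eta'}}\right)\quad\text{for all } i\in\{2,\dots,m\}.$$ (If $|\mathcal A|=1$, where the formula for $t_k$ has no meaning, put $t_k=1$.) -/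

import Mathlib

/-! ### Moore-Penrose inverse of a real square matrix -/

/-- `X` is a Moore-Penrose inverse of the real square matrix `A` (the four Penrose equations). -/
structure IsMoorePenrose {ι : Type*} [Fintype ι] (A X : Matrix ι ι ℝ) : Prop where
  mul_mul_self : A * X * A = A
  mul_mul_inv : X * A * X = X
  symm_left : (A * X).transpose = A * X
  symm_right : (X * A).transpose = X * A

/-- A Moore-Penrose inverse is unique. -/
theorem IsMoorePenrose.unique {ι : Type*} [Fintype ι] {A X Y : Matrix ι ι ℝ}
    (hX : IsMoorePenrose A X) (hY : IsMoorePenrose A Y) : X = Y := by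
  have h1 : A * X = A * Y := by
    calc A * X = (A * X).transpose := hX.symm_left.symm
      _ = (A * Y * A * X).transpose := by rw [hY.mul_mul_self]
      _ = (A * X).transpose * (A * Y).transpose := by
        rw [← Matrix.transpose_mul]; simp only [Matrix.mul_assoc]
      _ = A * X * A * Y := by rw [hX.symm_left, hY.symm_left]; simp only [Matrix.mul_assoc]
      _ = A * Y := by rw [hX.mul_mul_self]
  have h2 : X * A = Y * A := by
    calc X * A = (X * A).transpose := hX.symm_right.symm
      _ = (X * (A * Y * A)).transpose := by rw [hY.mul_mul_self]
      _ = (Y * A).transpose * (X * A).transpose := by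
        rw [← Matrix.transpose_mul]; simp only [Matrix.mul_assoc]
      _ = Y * (A * X * A) := by rw [hX.symm_right, hY.symm_right]; simp only [Matrix.mul_assoc]
      _ = Y * A := by rw [hX.mul_mul_self]
  calc X = X * A * X := hX.mul_mul_inv.symm
    _ = Y * (A * X) := by rw [h2, Matrix.mul_assoc]
    _ = Y * A * Y := by rw [h1, Matrix.mul_assoc]
    _ = Y := hY.mul_mul_inv

/-- Every real symmetric matrix has a Moore-Penrose inverse. -/
theorem exists_isMoorePenrose {ι : Type*} [Fintype ι] [DecidableEq ι] {A : Matrix ι ι ℝ}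
    (hA : A.IsHermitian) : ∃ X, IsMoorePenrose A X := by
  set U : Matrix ι ι ℝ := (hA.eigenvectorUnitary : Matrix ι ι ℝ) with hU
  have hUU : star U * U = 1 := Unitary.coe_star_mul_self hA.eigenvectorUnitary
  have hAs : A = U * Matrix.diagonal hA.eigenvalues * star U := by
    have h := hA.spectral_theorem
    rw [Unitary.conjStarAlgAut_apply] at h
    simpa [Function.comp_def] using h
  set D := Matrix.diagonal hA.eigenvalues with hD
  set E : Matrix ι ι ℝ := Matrix.diagonal (fun i => (hA.eigenvalues i)⁻¹) with hE
  have key : ∀ B C : Matrix ι ι ℝ, (U * B * star U) * (U * C * star U) = U * (B * C) * star U := by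
    intro B C
    calc (U * B * star U) * (U * C * star U) = U * B * (star U * U) * C * star U := by
          simp only [Matrix.mul_assoc]
      _ = U * (B * C) * star U := by rw [hUU]; simp only [Matrix.mul_assoc, Matrix.one_mul]
  have hsym : ∀ d : ι → ℝ, (U * Matrix.diagonal d * star U).transpose =
      U * Matrix.diagonal d * star U := by
    intro d
    have hs : star U = U.transpose := by
      rw [Matrix.star_eq_conjTranspose, Matrix.conjTranspose_eq_transpose_of_trivial]
    rw [hs]
    simp [Matrix.transpose_mul, Matrix.mul_assoc]
  refine ⟨U * E * star U, ?_, ?_, ?_, ?_⟩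
  · rw [hAs, key, key]
    congr 2
    simp only [hD, hE, Matrix.diagonal_mul_diagonal]
    congr 1; funext i; exact mul_inv_mul_cancel _
  · rw [hAs, key, key]
    congr 2
    simp only [hD, hE, Matrix.diagonal_mul_diagonal]
    congr 1; funext i
    simpa using mul_inv_mul_cancel (hA.eigenvalues i)⁻¹
  · rw [hAs, key, hD, hE, Matrix.diagonal_mul_diagonal, hsym]
  · rw [hAs, key, hD, hE, Matrix.diagonal_mul_diagonal, hsym]

open Classical in
/-- The Moore-Penrose inverse `A†`. -/
noncomputable def moorePenrose {ι : Type*} [Fintype ι] (A : Matrix ι ι ℝ) : Matrix ι ι ℝ :=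
  if h : ∃ X, IsMoorePenrose A X then h.choose else 0

/-- `moorePenrose A` is the Moore-Penrose inverse of `A` for every real symmetric `A`. -/
theorem isMoorePenrose_moorePenrose {ι : Type*} [Fintype ι] [DecidableEq ι] {A : Matrix ι ι ℝ}
    (hA : A.IsHermitian) : IsMoorePenrose A (moorePenrose A) := by
  have h := exists_isMoorePenrose hA
  rw [moorePenrose, dif_pos h]
  exact h.choose_spec

/-! ### Gradients in coordinates, softmax policies -/

/-- The gradient of `f : ℝ^ι → ℝ` at `x`, i.e. the vector of partial derivatives. -/
noncomputable def gradVec {ι : Type*} [Fintype ι] [DecidableEq ι] (f : (ι → ℝ) → ℝ) (x : ι → ℝ) :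
    ι → ℝ :=
  fun p => fderiv ℝ f x (Pi.single p 1)

/-- `π : S → Δ(A)`, i.e. `π s a` is the probability of the action `a` in the state `s`. -/
structure IsPolicy {S A : Type*} [Fintype A] (π : S → A → ℝ) : Prop where
  nonneg : ∀ s a, 0 ≤ π s a
  sum_eq_one : ∀ s, ∑ a, π s a = 1

/-- The softmax policy `π_θ(a|s) = exp θ_{s,a} / ∑_{a'} exp θ_{s,a'}`. -/
noncomputable def softmaxPolicy {S A : Type*} [Fintype A] (θ : S × A → ℝ) : S → A → ℝ :=
  fun s a => Real.exp (θ (s, a)) / ∑ a', Real.exp (θ (s, a'))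

/-- Kullback-Leibler divergence between two probability vectors (with `0 log 0 = 0`). -/
noncomputable def klVec {A : Type*} [Fintype A] (x y : A → ℝ) : ℝ :=
  ∑ a, x a * Real.log (x a / y a)

/-! ### Constrained Markov decision processes -/

/-- A finite discounted constrained MDP with `m = n + 1` reward functions. The reward `r 0` is the
objective; the reward `r i.succ` is subject to the constraint with threshold `b i`, `i : Fin n`. -/
structure CMDP (S A : Type*) [Fintype S] [Fintype A] (n : ℕ) where
  /-- transition probabilities: `P s a s'` is the probability of `s'` given `(s, a)` -/
  P : S → A → S → ℝ
  P_nonneg : ∀ s a s', 0 ≤ P s a s'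
  P_sum : ∀ s a, ∑ s', P s a s' = 1
  /-- initial state distribution -/
  ρ : S → ℝ
  ρ_nonneg : ∀ s, 0 ≤ ρ s
  ρ_sum : ∑ s, ρ s = 1
  /-- discount factor -/
  γ : ℝ
  γ_pos : 0 < γ
  γ_lt_one : γ < 1
  /-- reward functions -/
  r : Fin (n + 1) → S → A → ℝ
  r_nonneg : ∀ i s a, 0 ≤ r i s a
  r_le_one : ∀ i s a, r i s a ≤ 1
  /-- constraint thresholds -/
  b : Fin n → ℝ
  b_nonneg : ∀ i, 0 ≤ b i
  b_le : ∀ i, b i ≤ 1 / (1 - γ)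

namespace CMDP

variable {S A : Type*} [Fintype S] [Fintype A] {n : ℕ} (M : CMDP S A n)

/-- `ℙ(s_t = s | s_0 = s₀, π)` for the Markov chain induced by the policy `π`. -/
noncomputable def stateProb [DecidableEq S] (π : S → A → ℝ) (s₀ : S) : ℕ → S → ℝ
  | 0 => fun s => if s = s₀ then 1 else 0
  | t + 1 => fun s => ∑ s', ∑ a', stateProb π s₀ t s' * π s' a' * M.P s' a' s

/-- State value function `V^π_r(s₀) = 𝔼[∑_t γ^t r(s_t, a_t) | s_0 = s₀, π]`, where
`ℙ(s_t = s, a_t = a | s_0 = s₀, π) = ℙ(s_t = s | s_0 = s₀, π) π(a|s)`. -/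
noncomputable def stateValue [DecidableEq S] (π : S → A → ℝ) (r : S → A → ℝ) (s₀ : S) : ℝ :=
  ∑' t : ℕ, M.γ ^ t * ∑ s, ∑ a, M.stateProb π s₀ t s * π s a * r s a

/-- `V^π_r(ρ) = 𝔼_{s ∼ ρ}[V^π_r(s)]`. -/
noncomputable def value [DecidableEq S] (π : S → A → ℝ) (r : S → A → ℝ) : ℝ :=
  ∑ s, M.ρ s * M.stateValue π r s

/-- `V^π_i(ρ)` for the `i`-th reward function (`i = 0` is the objective). -/
noncomputable def V [DecidableEq S] (π : S → A → ℝ) (i : Fin (n + 1)) : ℝ :=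
  M.value π (M.r i)

/-- Discounted state visitation distribution `d^π_ρ(s)`. -/
noncomputable def stateVisit [DecidableEq S] (π : S → A → ℝ) (s : S) : ℝ :=
  ∑ s₀, M.ρ s₀ * ((1 - M.γ) * ∑' t : ℕ, M.γ ^ t * M.stateProb π s₀ t s)

/-- Discounted state-action visitation distribution `d^π_ρ(s, a)`. -/
noncomputable def stateActionVisit [DecidableEq S] (π : S → A → ℝ) (s : S) (a : A) : ℝ :=
  (1 - M.γ) * ∑ s₀, M.ρ s₀ * ∑' t : ℕ, M.γ ^ t * (M.stateProb π s₀ t s * π s a)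

/-- `D_{d^π_ρ}(π ‖ π') = ∑_s d^π_ρ(s) D(π(·|s) ‖ π'(·|s))`. -/
noncomputable def visitKL [DecidableEq S] (π π' : S → A → ℝ) : ℝ :=
  ∑ s, M.stateVisit π s * klVec (π s) (π' s)

/-! #### The constrained problem and its dual -/

/-- `π` satisfies all the constraints `V^π_i(ρ) ≥ b_i`. -/
def Feasible [DecidableEq S] (π : S → A → ℝ) : Prop :=
  ∀ i : Fin n, M.b i ≤ M.V π i.succ

/-- `π` is an optimal policy of the constrained problem. -/
structure IsOptimal [DecidableEq S] (π : S → A → ℝ) : Prop where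
  isPolicy : IsPolicy π
  feasible : M.Feasible π
  le_of_feasible : ∀ π' : S → A → ℝ, IsPolicy π' → M.Feasible π' → M.V π' 0 ≤ M.V π 0

/-- The Lagrangian of the constrained problem. -/
noncomputable def lagrangian [DecidableEq S] (π : S → A → ℝ) (lam : Fin n → ℝ) : ℝ :=
  M.V π 0 + ∑ i, lam i * (M.V π i.succ - M.b i)

/-- The Lagrange dual function `λ ↦ max_π L(π, λ)`. -/
noncomputable def dualFunction [DecidableEq S] (lam : Fin n → ℝ) : ℝ :=
  ⨆ π : {π : S → A → ℝ // IsPolicy π}, M.lagrangian π.1 lam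

/-- `lam` is an optimal dual variable: a minimizer of the dual function over `λ ≥ 0`. -/
structure IsDualOptimal [DecidableEq S] (lam : Fin n → ℝ) : Prop where
  nonneg : ∀ i, 0 ≤ lam i
  dual_le : ∀ lam' : Fin n → ℝ, (∀ i, 0 ≤ lam' i) → M.dualFunction lam ≤ M.dualFunction lam'

/-! #### The algorithm -/

/-- Fisher information matrix
`𝔼_{(s,a) ∼ d^{π_θ}_ρ}[∇_θ log π_θ(a|s) (∇_θ log π_θ(a|s))ᵀ]`. -/
noncomputable def fisher [DecidableEq S] [DecidableEq A] (θ : S × A → ℝ) :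
    Matrix (S × A) (S × A) ℝ :=
  ∑ s, ∑ a, M.stateActionVisit (softmaxPolicy θ) s a •
    Matrix.vecMulVec (gradVec (fun θ' => Real.log (softmaxPolicy θ' s a)) θ)
      (gradVec (fun θ' => Real.log (softmaxPolicy θ' s a)) θ)

/-- The Fisher information matrix is symmetric. -/
theorem fisher_isHermitian [DecidableEq S] [DecidableEq A] (θ : S × A → ℝ) :
    (M.fisher θ).IsHermitian := by
  ext p q
  simp [fisher, Matrix.sum_apply, Matrix.vecMulVec_apply, mul_comm]

/-- KL-regularized value `V^{π_θ}_r(ρ) - α D_{d^{π_θ}_ρ}(π_θ ‖ π_{θ_k}) / (1 - γ)` with the anchor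
policy `π_{θ_k}`, as a function of `θ`. -/
noncomputable def regValue [DecidableEq S] (r : S → A → ℝ) (α : ℝ) (θk θ : S × A → ℝ) : ℝ :=
  M.value (softmaxPolicy θ) r
    - α * (M.visitKL (softmaxPolicy θ) (softmaxPolicy θk) / (1 - M.γ))

/-- `InnerLoop(r, π_{θ_k}, α, η, t)`: the parameter after `t` natural policy gradient steps on the
regularized value with anchor `π_{θ_k}`, started at `θ_k`. -/
noncomputable def innerLoop [DecidableEq S] [DecidableEq A] (r : S → A → ℝ) (θk : S × A → ℝ)
    (α η : ℝ) : ℕ → S × A → ℝ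
  | 0 => θk
  | t + 1 =>
      innerLoop r θk α η t + η • (moorePenrose (M.fisher (innerLoop r θk α η t))).mulVec
        (gradVec (M.regValue r α θk) (innerLoop r θk α η t))

/-- The reward in the ascent direction
`r_1(s,a) + ∑_i (λ_i + η' (b_i - V^π_i(ρ))) r_i(s,a)` at the current policy `π`. -/
noncomputable def ascentReward [DecidableEq S] (η' : ℝ) (π : S → A → ℝ) (lam : Fin n → ℝ) :
    S → A → ℝ :=
  fun s a => M.r 0 s a + ∑ i, (lam i + η' * (M.b i - M.V π i.succ)) * M.r i.succ s a

/-- ARNPG-EPD: the pair `(θ_k, λ_k)` after `k` macro steps, started at the parameter `θ₀`, with the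
numbers `t 0, t 1, …` of micro steps. -/
noncomputable def epd [DecidableEq S] [DecidableEq A] (θ₀ : S × A → ℝ) (η' α η : ℝ) (t : ℕ → ℕ) :
    ℕ → (S × A → ℝ) × (Fin n → ℝ)
  | 0 => (θ₀, fun i => max (η' * (M.V (softmaxPolicy θ₀) i.succ - M.b i)) 0)
  | k + 1 =>
      let θ := (epd θ₀ η' α η t k).1
      let lam := (epd θ₀ η' α η t k).2
      let θ' := M.innerLoop (M.ascentReward η' (softmaxPolicy θ) lam) θ α η (t k)
      (θ', fun i => max (η' * (M.V (softmaxPolicy θ') i.succ - M.b i))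
        (lam i + η' * (M.b i - M.V (softmaxPolicy θ') i.succ)))

/-- The policy `π_k` of ARNPG-EPD. -/
noncomputable def epdPolicy [DecidableEq S] [DecidableEq A] (θ₀ : S × A → ℝ) (η' α η : ℝ)
    (t : ℕ → ℕ) (k : ℕ) : S → A → ℝ :=
  softmaxPolicy (M.epd θ₀ η' α η t k).1

/-- The dual variable `λ_k` of ARNPG-EPD. -/
noncomputable def epdDual [DecidableEq S] [DecidableEq A] (θ₀ : S × A → ℝ) (η' α η : ℝ)
    (t : ℕ → ℕ) (k : ℕ) : Fin n → ℝ :=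
  (M.epd θ₀ η' α η t k).2

end CMDP

/-! ### Discounted occupation measures, Bellman equations, performance differences -/

/-! Each macro step is an approximate proximal step, and the dual update makes the proximal
inequalities telescope.

Inner loop. The Fisher matrix annihilates only directions constant in the action, at reachable
states. With step size `(1 - γ) / α` a natural gradient step is therefore one step of soft policy
iteration: the new policy is the anchor reweighted by the exponential of the soft Q-function over
`α` (`exists_innerLoop_succ_eq`). The soft Bellman residual decays like `γ ^ j`
(`softBellman_innerValue_le`), and the performance difference formula turns this into a three-point
inequality with a small error (`value_sub_visitKL_add_visitKL_le`). Parameters at unreachable states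
are not tracked, so statewise estimates involving the iterates are restricted to `Reach`.

Outer loop. Let `g k` be the constraint violations. The ascent reward weighs constraint `i` by `λ_k
+ η' g_k ≥ 0`. Comparing with an optimal policy and expanding the cross term `g_k g_{k+1}`, the
potential `η'/2 ‖g_k‖² - ‖λ_k‖²/(2η')` telescopes (`sum_range_sub_le_of_drift`). What remains is
`‖g_k - g_{k+1}‖²`, which the proximal divergence absorbs: values are Lipschitz in the policy by a
Pinsker inequality (`sq_V_sub_le`), and this fixes the lower bound on `α`. Since `|η' g_K| ≤ λ_K`,
the final potential is nonpositive and the optimality gap follows.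

Constraints. The updates accumulate violations, so `η' ∑ g ≤ λ_K` and it suffices to bound `‖λ_K‖`.
The regret bound contains `-‖λ_K‖²/(2η')`, while the saddle point property of `λ*` bounds the regret
below by `-‖λ*‖‖λ_K‖/η'`; together they give a quadratic inequality for `‖λ_K‖`. The saddle point
comes from separating attainable value vectors from an orthant (`exists_dualFunction_le`); Slater's
condition is not needed, because `λ*` is given. -/

theorem IsPolicy.sum_mul_nonneg {S A : Type*} [Fintype A] {π r : S → A → ℝ} (hπ : IsPolicy π)
    (hr : ∀ s a, 0 ≤ r s a) (s : S) : 0 ≤ ∑ a, π s a * r s a :=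
  Finset.sum_nonneg fun a _ => mul_nonneg (hπ.nonneg s a) (hr s a)

theorem IsPolicy.sum_mul_le {S A : Type*} [Fintype A] {π r : S → A → ℝ} (hπ : IsPolicy π) {B : ℝ}
    (hr : ∀ s a, r s a ≤ B) (s : S) : ∑ a, π s a * r s a ≤ B :=
  calc ∑ a, π s a * r s a ≤ ∑ a, π s a * B :=
        Finset.sum_le_sum fun a _ => mul_le_mul_of_nonneg_left (hr s a) (hπ.nonneg s a)
    _ = B := by rw [← Finset.sum_mul, hπ.sum_eq_one, one_mul]

namespace CMDP

variable {S A : Type*} [Fintype S] [Fintype A] {n : ℕ} (M : CMDP S A n)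

theorem one_sub_γ_pos : 0 < 1 - M.γ := sub_pos.2 M.γ_lt_one

/-- Expected value of `W` at the next state. -/
noncomputable def next (W : S → ℝ) (s : S) (a : A) : ℝ := ∑ s', M.P s a s' * W s'

theorem next_const (c : ℝ) (s : S) (a : A) : M.next (fun _ => c) s a = c := by
  rw [next, ← Finset.sum_mul, M.P_sum, one_mul]

/-- States that can be visited from the initial distribution. -/
inductive Reach : S → Prop
  | init {s : S} : 0 < M.ρ s → Reach s
  | step {s s' : S} (a : A) : Reach s → 0 < M.P s a s' → Reach s'

variable {M} in
theorem Reach.next_mono {s : S} (hs : M.Reach s) (a : A) {W W' : S → ℝ}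
    (h : ∀ s, M.Reach s → W s ≤ W' s) : M.next W s a ≤ M.next W' s a := by
  refine Finset.sum_le_sum fun s' _ => ?_
  rcases (M.P_nonneg s a s').eq_or_lt with h0 | h0
  · simp [← h0]
  · exact mul_le_mul_of_nonneg_left (h s' (hs.step a h0)) h0.le

/-- The Bellman operator of the policy `π`. -/
noncomputable def bellman (π r : S → A → ℝ) (W : S → ℝ) (s : S) : ℝ :=
  ∑ a, π s a * (r s a + M.γ * M.next W s a)

variable [DecidableEq S]

theorem stateProb_nonneg {π : S → A → ℝ} (hπ : IsPolicy π) (s₀ : S) (t : ℕ) (s : S) :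
    0 ≤ M.stateProb π s₀ t s := by
  induction t generalizing s with
  | zero => simp only [stateProb]; split_ifs <;> norm_num
  | succ t ih =>
    exact Finset.sum_nonneg fun s' _ => Finset.sum_nonneg fun a' _ =>
      mul_nonneg (mul_nonneg (ih s') (hπ.nonneg s' a')) (M.P_nonneg s' a' s)

/-- One step of the Markov chain, tested against a function. -/
theorem sum_stateProb_succ (π : S → A → ℝ) (s₀ : S) (t : ℕ) (W : S → ℝ) :
    ∑ s, M.stateProb π s₀ (t + 1) s * W s =
      ∑ s, M.stateProb π s₀ t s * ∑ a, π s a * M.next W s a := by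
  simp only [stateProb, next, Finset.sum_mul, Finset.mul_sum]
  rw [Finset.sum_comm]
  refine Finset.sum_congr rfl fun s' _ => ?_
  rw [Finset.sum_comm]
  exact Finset.sum_congr rfl fun a _ => Finset.sum_congr rfl fun s _ => by ring

theorem stateProb_sum {π : S → A → ℝ} (hπ : IsPolicy π) (s₀ : S) (t : ℕ) :
    ∑ s, M.stateProb π s₀ t s = 1 := by
  induction t with
  | zero => simp [stateProb]
  | succ t ih =>
    have h := M.sum_stateProb_succ π s₀ t fun _ => 1
    simpa [next_const, hπ.sum_eq_one, ih] using h

theorem stateProb_le_one {π : S → A → ℝ} (hπ : IsPolicy π) (s₀ : S) (t : ℕ) (s : S) :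
    M.stateProb π s₀ t s ≤ 1 := by
  rw [← M.stateProb_sum hπ s₀ t]
  exact Finset.single_le_sum (fun s _ => M.stateProb_nonneg hπ s₀ t s) (Finset.mem_univ s)

theorem reach_of_stateProb_ne_zero {π : S → A → ℝ} {s₀ : S} (hs₀ : M.Reach s₀)
    {t : ℕ} {s : S} (h : M.stateProb π s₀ t s ≠ 0) : M.Reach s := by
  induction t generalizing s with
  | zero =>
    have : s = s₀ := by
      by_contra hne
      exact h (by simp [stateProb, hne])
    exact this ▸ hs₀
  | succ t ih =>
    obtain ⟨s', -, h'⟩ := Finset.exists_ne_zero_of_sum_ne_zero h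
    obtain ⟨a, -, h''⟩ := Finset.exists_ne_zero_of_sum_ne_zero h'
    exact (ih (left_ne_zero_of_mul (left_ne_zero_of_mul h''))).step a
      ((M.P_nonneg s' a s).lt_of_ne' (right_ne_zero_of_mul h''))

/-- Discounted expected number of visits to `s` of the chain started at `s₀`. -/
noncomputable def occ (π : S → A → ℝ) (s₀ s : S) : ℝ := ∑' t : ℕ, M.γ ^ t * M.stateProb π s₀ t s

theorem summable_occ {π : S → A → ℝ} (hπ : IsPolicy π) (s₀ s : S) :
    Summable fun t : ℕ => M.γ ^ t * M.stateProb π s₀ t s := by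
  refine Summable.of_nonneg_of_le
    (fun t => mul_nonneg (pow_nonneg M.γ_pos.le t) (M.stateProb_nonneg hπ s₀ t s)) (fun t => ?_)
    (summable_geometric_of_lt_one M.γ_pos.le M.γ_lt_one)
  exact mul_le_of_le_one_right (pow_nonneg M.γ_pos.le t) (M.stateProb_le_one hπ s₀ t s)

theorem occ_nonneg {π : S → A → ℝ} (hπ : IsPolicy π) (s₀ s : S) : 0 ≤ M.occ π s₀ s :=
  tsum_nonneg fun t => mul_nonneg (pow_nonneg M.γ_pos.le t) (M.stateProb_nonneg hπ s₀ t s)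

theorem reach_of_occ_ne_zero {π : S → A → ℝ} {s₀ : S} (hs₀ : M.Reach s₀) {s : S}
    (h : M.occ π s₀ s ≠ 0) : M.Reach s := by
  by_contra hs
  refine h ?_
  have : ∀ t, M.γ ^ t * M.stateProb π s₀ t s = 0 := fun t => by
    by_contra h'
    exact hs (M.reach_of_stateProb_ne_zero hs₀ (right_ne_zero_of_mul h'))
  simp [occ, this]

theorem hasSum_occ_mul {π : S → A → ℝ} (hπ : IsPolicy π) (s₀ : S) (f : S → ℝ) :
    HasSum (fun t : ℕ => M.γ ^ t * ∑ s, M.stateProb π s₀ t s * f s) (∑ s, M.occ π s₀ s * f s) := by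
  have h := hasSum_sum fun s (_ : s ∈ Finset.univ) =>
    ((M.summable_occ hπ s₀ s).hasSum).mul_right (f s)
  exact h.congr_fun fun t => by simp only [Finset.mul_sum, mul_assoc]

/-- Telescoping: shifting the series `∑ γ^t 𝔼[W(s_t)]` by one leaves only its term at `t = 0`. Thus
`occ` inverts `I - γ P_π`, the source of all performance differences below. -/
theorem sum_occ_mul_sub {π : S → A → ℝ} (hπ : IsPolicy π) (s₀ : S) (W : S → ℝ) :
    ∑ s, M.occ π s₀ s * (W s - M.γ * ∑ a, π s a * M.next W s a) = W s₀ := by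
  have h1 := M.hasSum_occ_mul hπ s₀ W
  have h2 := (M.hasSum_occ_mul hπ s₀ fun s => ∑ a, π s a * M.next W s a).mul_left M.γ
  have h3 := (hasSum_nat_add_iff' (f := fun t : ℕ => M.γ ^ t * ∑ s, M.stateProb π s₀ t s * W s)
    1).2 h1
  have h4 := h2.unique (h3.congr_fun fun t => by rw [sum_stateProb_succ, pow_succ]; ring)
  simp only [mul_sub, Finset.sum_sub_distrib]
  simp only [Finset.range_one, Finset.sum_singleton, pow_zero, one_mul, stateProb, ite_mul,
    zero_mul, Finset.sum_ite_eq', Finset.mem_univ, if_true] at h4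
  have h5 : ∑ s, M.occ π s₀ s * (M.γ * ∑ a, π s a * M.next W s a) =
      M.γ * ∑ s, M.occ π s₀ s * ∑ a, π s a * M.next W s a := by
    rw [Finset.mul_sum]; exact Finset.sum_congr rfl fun s _ => by ring
  rw [h5, h4]; ring

theorem sum_occ {π : S → A → ℝ} (hπ : IsPolicy π) (s₀ : S) :
    ∑ s, M.occ π s₀ s = 1 / (1 - M.γ) := by
  have h := M.sum_occ_mul_sub hπ s₀ fun _ => 1
  simp only [next_const, mul_one, hπ.sum_eq_one] at h
  rw [← Finset.sum_mul] at h
  exact eq_div_of_mul_eq M.one_sub_γ_pos.ne' h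

theorem stateValue_eq_sum_occ {π : S → A → ℝ} (hπ : IsPolicy π) (r : S → A → ℝ) (s₀ : S) :
    M.stateValue π r s₀ = ∑ s, M.occ π s₀ s * ∑ a, π s a * r s a := by
  rw [← (M.hasSum_occ_mul hπ s₀ _).tsum_eq, stateValue]
  simp only [Finset.mul_sum, mul_assoc]

/-- Performance difference, with an arbitrary comparison function `W`. -/
theorem stateValue_sub {π : S → A → ℝ} (hπ : IsPolicy π) (r : S → A → ℝ) (W : S → ℝ) (s₀ : S) :
    M.stateValue π r s₀ - W s₀ = ∑ s, M.occ π s₀ s * (M.bellman π r W s - W s) := by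
  nth_rewrite 1 [← M.sum_occ_mul_sub hπ s₀ W]
  rw [M.stateValue_eq_sum_occ hπ, ← Finset.sum_sub_distrib]
  refine Finset.sum_congr rfl fun s _ => ?_
  have : M.bellman π r W s = ∑ a, π s a * r s a + M.γ * ∑ a, π s a * M.next W s a := by
    rw [bellman, Finset.mul_sum, ← Finset.sum_add_distrib]
    exact Finset.sum_congr rfl fun a _ => by ring
  rw [this]; ring

/-- The Bellman equation. -/
theorem bellman_stateValue {π : S → A → ℝ} (hπ : IsPolicy π) (r : S → A → ℝ) :
    M.bellman π r (M.stateValue π r) = M.stateValue π r := by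
  let B : (S → ℝ) →ₗ[ℝ] (S → ℝ) :=
    { toFun := fun W s => W s - M.γ * ∑ a, π s a * M.next W s a
      map_add' := fun W W' => by
        funext s
        simp only [next, Pi.add_apply, mul_add, Finset.sum_add_distrib]; ring
      map_smul' := fun c W => by
        funext s
        simp only [next, Pi.smul_apply, smul_eq_mul, RingHom.id_apply, Finset.mul_sum, mul_sub]
        congr 1
        refine Finset.sum_congr rfl fun a _ => Finset.sum_congr rfl fun s' _ => by ring }
  -- `occ` recovers `W` from `B W`, so `B = I - γ P_π` is injective, hence onto in finite dimension.
  -- The resulting solution has zero Bellman residual, and the performance difference identifies it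
  -- with the value.
  have hB : Function.Injective B := by
    rw [← LinearMap.ker_eq_bot, LinearMap.ker_eq_bot']
    intro W hW
    funext s₀
    have h : ∀ s, W s - M.γ * ∑ a, π s a * M.next W s a = 0 := fun s => congrFun hW s
    rw [← M.sum_occ_mul_sub hπ s₀ W]
    simp [h]
  obtain ⟨W, hW⟩ := LinearMap.injective_iff_surjective.1 hB fun s => ∑ a, π s a * r s a
  have hW' : ∀ s, M.bellman π r W s = W s := fun s => by
    have h : W s - M.γ * ∑ a, π s a * M.next W s a = ∑ a, π s a * r s a := congrFun hW s
    have : M.bellman π r W s = ∑ a, π s a * r s a + M.γ * ∑ a, π s a * M.next W s a := by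
      rw [bellman, Finset.mul_sum, ← Finset.sum_add_distrib]
      exact Finset.sum_congr rfl fun a _ => by ring
    rw [this, ← h]; ring
  have : M.stateValue π r = W := funext fun s => by
    have h := M.stateValue_sub hπ r W s
    simp only [hW', sub_self, mul_zero, Finset.sum_const_zero] at h
    linarith
  rw [this]; exact funext hW'

/-- A subsolution of the Bellman equation is below the value function. -/
theorem le_stateValue {π : S → A → ℝ} (hπ : IsPolicy π) (r : S → A → ℝ) (W : S → ℝ)
    (hW : ∀ s, M.Reach s → W s ≤ M.bellman π r W s) {s : S} (hs : M.Reach s) :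
    W s ≤ M.stateValue π r s := by
  rw [← sub_nonneg, M.stateValue_sub hπ]
  refine Finset.sum_nonneg fun s' _ => ?_
  by_cases h : M.occ π s s' = 0
  · simp [h]
  · exact mul_nonneg (M.occ_nonneg hπ s s') (sub_nonneg.2 (hW s' (M.reach_of_occ_ne_zero hs h)))

theorem stateValue_nonneg {π : S → A → ℝ} (hπ : IsPolicy π) {r : S → A → ℝ}
    (hr : ∀ s, 0 ≤ ∑ a, π s a * r s a) (s : S) : 0 ≤ M.stateValue π r s := by
  rw [M.stateValue_eq_sum_occ hπ]
  exact Finset.sum_nonneg fun s' _ => mul_nonneg (M.occ_nonneg hπ s s') (hr s')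

theorem stateValue_le {π : S → A → ℝ} (hπ : IsPolicy π) {r : S → A → ℝ} {B : ℝ}
    (hr : ∀ s, ∑ a, π s a * r s a ≤ B) (s : S) : M.stateValue π r s ≤ B / (1 - M.γ) := by
  rw [M.stateValue_eq_sum_occ hπ]
  calc ∑ s', M.occ π s s' * ∑ a, π s' a * r s' a ≤ ∑ s', M.occ π s s' * B :=
        Finset.sum_le_sum fun s' _ => mul_le_mul_of_nonneg_left (hr s') (M.occ_nonneg hπ s s')
    _ = B / (1 - M.γ) := by rw [← Finset.sum_mul, M.sum_occ hπ]; ring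

theorem value_nonneg {π : S → A → ℝ} (hπ : IsPolicy π) {r : S → A → ℝ}
    (hr : ∀ s a, 0 ≤ r s a) : 0 ≤ M.value π r :=
  Finset.sum_nonneg fun s _ =>
    mul_nonneg (M.ρ_nonneg s) (M.stateValue_nonneg hπ (hπ.sum_mul_nonneg hr) s)

theorem value_le {π : S → A → ℝ} (hπ : IsPolicy π) {r : S → A → ℝ} {B : ℝ}
    (hr : ∀ s a, r s a ≤ B) : M.value π r ≤ B / (1 - M.γ) :=
  calc M.value π r ≤ ∑ s, M.ρ s * (B / (1 - M.γ)) := Finset.sum_le_sum fun s _ =>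
        mul_le_mul_of_nonneg_left (M.stateValue_le hπ (hπ.sum_mul_le hr) s) (M.ρ_nonneg s)
    _ = B / (1 - M.γ) := by rw [← Finset.sum_mul, M.ρ_sum, one_mul]

theorem V_nonneg {π : S → A → ℝ} (hπ : IsPolicy π) (i : Fin (n + 1)) : 0 ≤ M.V π i :=
  M.value_nonneg hπ (M.r_nonneg i)

theorem V_le {π : S → A → ℝ} (hπ : IsPolicy π) (i : Fin (n + 1)) : M.V π i ≤ 1 / (1 - M.γ) :=
  M.value_le hπ (M.r_le_one i)

theorem stateVisit_eq (π : S → A → ℝ) (s : S) :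
    M.stateVisit π s = (1 - M.γ) * ∑ s₀, M.ρ s₀ * M.occ π s₀ s := by
  rw [stateVisit, Finset.mul_sum]
  exact Finset.sum_congr rfl fun s₀ _ => by rw [occ]; ring

theorem stateActionVisit_eq (π : S → A → ℝ) (s : S) (a : A) :
    M.stateActionVisit π s a = M.stateVisit π s * π s a := by
  rw [stateVisit_eq, stateActionVisit, mul_assoc, Finset.sum_mul]
  congr 1
  refine Finset.sum_congr rfl fun s₀ _ => ?_
  rw [mul_assoc, occ, ← tsum_mul_right]
  simp only [mul_assoc]

theorem stateVisit_nonneg {π : S → A → ℝ} (hπ : IsPolicy π) (s : S) : 0 ≤ M.stateVisit π s := by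
  rw [stateVisit_eq]
  exact mul_nonneg M.one_sub_γ_pos.le (Finset.sum_nonneg fun s₀ _ =>
    mul_nonneg (M.ρ_nonneg s₀) (M.occ_nonneg hπ s₀ s))

theorem sum_stateVisit_mul (π : S → A → ℝ) (f : S → ℝ) :
    ∑ s, M.stateVisit π s * f s = (1 - M.γ) * ∑ s₀, M.ρ s₀ * ∑ s, M.occ π s₀ s * f s := by
  simp only [stateVisit_eq, Finset.mul_sum, Finset.sum_mul]
  rw [Finset.sum_comm]
  exact Finset.sum_congr rfl fun s₀ _ => Finset.sum_congr rfl fun s _ => by ring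

theorem sum_stateVisit {π : S → A → ℝ} (hπ : IsPolicy π) : ∑ s, M.stateVisit π s = 1 := by
  have h := M.sum_stateVisit_mul π fun _ => 1
  simp only [mul_one, M.sum_occ hπ, ← Finset.sum_mul, M.ρ_sum, one_mul] at h
  rw [h, mul_one_div_cancel M.one_sub_γ_pos.ne']

/-- Averages over visited states need statewise bounds only at reachable states, where the Fisher
matrix controls the step. -/
theorem reach_of_stateVisit_ne_zero {π : S → A → ℝ} {s : S} (h : M.stateVisit π s ≠ 0) :
    M.Reach s := by
  rw [stateVisit_eq] at h
  obtain ⟨s₀, -, h'⟩ := Finset.exists_ne_zero_of_sum_ne_zero (right_ne_zero_of_mul h)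
  exact M.reach_of_occ_ne_zero
    (.init ((M.ρ_nonneg s₀).lt_of_ne' (left_ne_zero_of_mul h'))) (right_ne_zero_of_mul h')

theorem sum_stateVisit_mul_le {π : S → A → ℝ} (hπ : IsPolicy π) {f : S → ℝ} {B : ℝ}
    (hf : ∀ s, M.Reach s → f s ≤ B) : ∑ s, M.stateVisit π s * f s ≤ B :=
  calc ∑ s, M.stateVisit π s * f s ≤ ∑ s, M.stateVisit π s * B := by
        refine Finset.sum_le_sum fun s _ => ?_
        by_cases h : M.stateVisit π s = 0
        · simp [h]
        · exact mul_le_mul_of_nonneg_left (hf s (M.reach_of_stateVisit_ne_zero h))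
            (M.stateVisit_nonneg hπ s)
    _ = B := by rw [← Finset.sum_mul, M.sum_stateVisit hπ, one_mul]

/-- The value is the expected reward under the visitation distribution. -/
theorem value_eq_sum_stateVisit {π : S → A → ℝ} (hπ : IsPolicy π) (r : S → A → ℝ) :
    M.value π r = 1 / (1 - M.γ) * ∑ s, M.stateVisit π s * ∑ a, π s a * r s a := by
  rw [sum_stateVisit_mul, ← mul_assoc, one_div_mul_cancel M.one_sub_γ_pos.ne', one_mul, value]
  simp only [M.stateValue_eq_sum_occ hπ]

/-- Performance difference for the initial distribution `ρ`. -/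
theorem value_sub {π : S → A → ℝ} (hπ : IsPolicy π) (r : S → A → ℝ) (W : S → ℝ) :
    M.value π r - ∑ s, M.ρ s * W s =
      1 / (1 - M.γ) * ∑ s, M.stateVisit π s * (M.bellman π r W s - W s) := by
  rw [sum_stateVisit_mul, ← mul_assoc, one_div_mul_cancel M.one_sub_γ_pos.ne', one_mul, value,
    ← Finset.sum_sub_distrib]
  exact Finset.sum_congr rfl fun s _ => by rw [← M.stateValue_sub hπ, mul_sub]

/-- The flow equation of the visitation distribution, in weak form. -/
theorem sum_stateVisit_mul_sub {π : S → A → ℝ} (hπ : IsPolicy π) (W : S → ℝ) :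
    ∑ s, M.stateVisit π s * (W s - M.γ * ∑ a, π s a * M.next W s a) =
      (1 - M.γ) * ∑ s, M.ρ s * W s := by
  simp only [sum_stateVisit_mul, M.sum_occ_mul_sub hπ]

theorem next_single (s : S) (s' : S) (a : A) : M.next (Pi.single s 1) s' a = M.P s' a s := by
  simp [next, Pi.single_apply]

/-- The flow equation of the visitation distribution. -/
theorem stateVisit_flow {π : S → A → ℝ} (hπ : IsPolicy π) (s : S) :
    M.stateVisit π s =
      (1 - M.γ) * M.ρ s + M.γ * ∑ s', M.stateVisit π s' * ∑ a, π s' a * M.P s' a s := by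
  have h := M.sum_stateVisit_mul_sub hπ (Pi.single s 1)
  simp only [next_single, mul_sub, Finset.sum_sub_distrib, Pi.single_apply, mul_ite, mul_one,
    mul_zero, Finset.sum_ite_eq', Finset.mem_univ, if_true] at h
  rw [← h, Finset.mul_sum]
  simp only [mul_left_comm M.γ, sub_add_cancel]

/-- Induction along a path: the flow equation passes positive mass on, since every action has
positive probability. -/
theorem Reach.stateVisit_pos {π : S → A → ℝ} (hπ : IsPolicy π) (hpos : ∀ s a, 0 < π s a) {s : S}
    (hs : M.Reach s) : 0 < M.stateVisit π s := by
  have hnn : ∀ s, 0 ≤ M.γ * ∑ s', M.stateVisit π s' * ∑ a, π s' a * M.P s' a s := fun s =>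
    mul_nonneg M.γ_pos.le (Finset.sum_nonneg fun s' _ => mul_nonneg (M.stateVisit_nonneg hπ s')
      (Finset.sum_nonneg fun a _ => mul_nonneg (hπ.nonneg s' a) (M.P_nonneg s' a s)))
  induction hs with
  | @init s h =>
    rw [M.stateVisit_flow hπ]
    exact add_pos_of_pos_of_nonneg (mul_pos M.one_sub_γ_pos h) (hnn s)
  | @step s s' a _ h ih =>
    rw [M.stateVisit_flow hπ]
    refine add_pos_of_nonneg_of_pos (mul_nonneg M.one_sub_γ_pos.le (M.ρ_nonneg s'))
      (mul_pos M.γ_pos ?_)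
    have h1 : 0 < ∑ a, π s a * M.P s a s' := (mul_pos (hpos s a) h).trans_le
      (Finset.single_le_sum (f := fun a => π s a * M.P s a s')
        (fun a _ => mul_nonneg (hπ.nonneg s a) (M.P_nonneg s a s')) (Finset.mem_univ a))
    exact (mul_pos ih h1).trans_le
      (Finset.single_le_sum (f := fun s => M.stateVisit π s * ∑ a, π s a * M.P s a s')
        (fun s _ => mul_nonneg (M.stateVisit_nonneg hπ s) (Finset.sum_nonneg fun a _ =>
          mul_nonneg (hπ.nonneg s a) (M.P_nonneg s a s'))) (Finset.mem_univ s))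

end CMDP

/-! ### Softmax policies -/

section Softmax

variable {S A : Type*} [Fintype A]

theorem softmaxPolicy_pos [Nonempty A] (θ : S × A → ℝ) (s : S) (a : A) :
    0 < softmaxPolicy θ s a :=
  div_pos (Real.exp_pos _) (Finset.sum_pos (fun _ _ => Real.exp_pos _) Finset.univ_nonempty)

theorem isPolicy_softmaxPolicy [Nonempty A] (θ : S × A → ℝ) : IsPolicy (softmaxPolicy θ) where
  nonneg s a := (softmaxPolicy_pos θ s a).le
  sum_eq_one s := by
    have : 0 < ∑ a, Real.exp (θ (s, a)) :=
      Finset.sum_pos (fun _ _ => Real.exp_pos _) Finset.univ_nonempty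
    simp only [softmaxPolicy]
    rw [← Finset.sum_div, div_self this.ne']

theorem log_softmaxPolicy [Nonempty A] (θ : S × A → ℝ) (s : S) (a : A) :
    Real.log (softmaxPolicy θ s a) = θ (s, a) - Real.log (∑ a', Real.exp (θ (s, a'))) := by
  have : 0 < ∑ a, Real.exp (θ (s, a)) :=
    Finset.sum_pos (fun _ _ => Real.exp_pos _) Finset.univ_nonempty
  rw [softmaxPolicy, Real.log_div (Real.exp_pos _).ne' this.ne', Real.log_exp]

/-- The score function `∇_θ log π_θ(a|s)`, as a linear functional. -/
noncomputable def score [Fintype S] (θ : S × A → ℝ) (s : S) (a : A) : (S × A → ℝ) →L[ℝ] ℝ :=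
  ContinuousLinearMap.proj (s, a) - ∑ b, softmaxPolicy θ s b • ContinuousLinearMap.proj (s, b)

theorem score_apply [Fintype S] (θ : S × A → ℝ) (s : S) (a : A) (v : S × A → ℝ) :
    score θ s a v = v (s, a) - ∑ b, softmaxPolicy θ s b * v (s, b) := by
  simp [score]

theorem hasFDerivAt_log_softmaxPolicy [Fintype S] [Nonempty A] (θ : S × A → ℝ) (s : S) (a : A) :
    HasFDerivAt (fun θ' => Real.log (softmaxPolicy θ' s a)) (score θ s a) θ := by
  simp only [log_softmaxPolicy]
  have hp : ∀ b, HasFDerivAt (fun θ' : S × A → ℝ => θ' (s, b))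
      (ContinuousLinearMap.proj (R := ℝ) (s, b) : (S × A → ℝ) →L[ℝ] ℝ) θ := fun b =>
    (ContinuousLinearMap.proj (R := ℝ) (s, b) : (S × A → ℝ) →L[ℝ] ℝ).hasFDerivAt
  have hpos : 0 < ∑ a, Real.exp (θ (s, a)) :=
    Finset.sum_pos (fun _ _ => Real.exp_pos _) Finset.univ_nonempty
  have h := (hp a).sub ((HasFDerivAt.fun_sum (u := Finset.univ) fun b _ => (hp b).exp).log hpos.ne')
  refine h.congr_fderiv ?_
  rw [score, Finset.smul_sum]
  congr 1
  refine Finset.sum_congr rfl fun b _ => ?_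
  rw [smul_smul, softmaxPolicy, div_eq_inv_mul]

theorem hasFDerivAt_softmaxPolicy [Fintype S] [Nonempty A] (θ : S × A → ℝ) (s : S) (a : A) :
    HasFDerivAt (fun θ' => softmaxPolicy θ' s a) (softmaxPolicy θ s a • score θ s a) θ := by
  have h := (hasFDerivAt_log_softmaxPolicy θ s a).exp
  simpa only [Real.exp_log (softmaxPolicy_pos _ s a)] using h

theorem sum_softmaxPolicy_mul_score [Fintype S] [Nonempty A] (θ : S × A → ℝ) (s : S)
    (v : S × A → ℝ) : ∑ a, softmaxPolicy θ s a * score θ s a v = 0 := by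
  simp only [score_apply, mul_sub, Finset.sum_sub_distrib, ← Finset.sum_mul,
    (isPolicy_softmaxPolicy θ).sum_eq_one, one_mul, sub_self]

theorem continuous_softmaxPolicy [Nonempty A] (s : S) (a : A) :
    Continuous fun θ : S × A → ℝ => softmaxPolicy θ s a := by
  simp only [softmaxPolicy]
  refine Continuous.div (by fun_prop) (by fun_prop) fun θ => ?_
  exact (Finset.sum_pos (fun _ _ => Real.exp_pos _) Finset.univ_nonempty).ne'

/-- The derivative of a product one of whose factors vanishes. -/
theorem HasFDerivAt.mul_of_eq_zero {E : Type*} [NormedAddCommGroup E] [NormedSpace ℝ E]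
    {f g : E → ℝ} {g' : E →L[ℝ] ℝ} {x : E} (hf : ContinuousAt f x) (hg : HasFDerivAt g g' x)
    (h0 : g x = 0) : HasFDerivAt (fun y => f y * g y) (f x • g') x := by
  rw [hasFDerivAt_iff_isLittleO] at *
  have h1 : (fun y => (f y - f x) * g y) =o[nhds x] fun y => y - x := by
    have hO : g =O[nhds x] fun y => y - x := by
      have := (hasFDerivAt_iff_isLittleO.2 hg).isBigO_sub
      simpa [h0] using this
    have ho : (fun y => f y - f x) =o[nhds x] fun _ => (1 : ℝ) := by
      rw [Asymptotics.isLittleO_one_iff]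
      simpa using hf.tendsto.sub_const (f x)
    have := ho.mul_isBigO hO.norm_right
    simpa using this
  refine (h1.add (hg.const_mul_left (f x))).congr_left fun y => ?_
  simp only [h0, _root_.smul_apply, smul_eq_mul]
  ring

/-- The reward with entropic regularization relative to the policy `ν`. -/
noncomputable def regReward (α : ℝ) (r ν π : S → A → ℝ) (s : S) (a : A) : ℝ :=
  r s a - α * Real.log (π s a / ν s a)

theorem sum_mul_regReward (α : ℝ) (r ν π : S → A → ℝ) (s : S) :
    ∑ a, π s a * regReward α r ν π s a = ∑ a, π s a * r s a - α * klVec (π s) (ν s) := by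
  rw [klVec, Finset.mul_sum, ← Finset.sum_sub_distrib]
  exact Finset.sum_congr rfl fun a _ => by rw [regReward]; ring

end Softmax

/-! ### The natural policy gradient step -/

namespace CMDP

variable {S A : Type*} [Fintype S] [DecidableEq S] [Fintype A] {n : ℕ} (M : CMDP S A n)

theorem continuous_stateVisit_softmaxPolicy [Nonempty A] (s : S) :
    Continuous fun θ : S × A → ℝ => M.stateVisit (softmaxPolicy θ) s := by
  have hP : ∀ (s₀ : S) (t : ℕ) (s : S),
      Continuous fun θ : S × A → ℝ => M.stateProb (softmaxPolicy θ) s₀ t s := by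
    intro s₀ t
    induction t with
    | zero => intro s; simp only [stateProb]; exact continuous_const
    | succ t ih =>
      intro s
      simp only [stateProb]
      exact continuous_finsetSum _ fun s' _ => continuous_finsetSum _ fun a _ =>
        ((ih s').mul (continuous_softmaxPolicy s' a)).mul continuous_const
  refine continuous_finsetSum _ fun s₀ _ => continuous_const.mul (continuous_const.mul ?_)
  refine continuous_tsum (fun t => continuous_const.mul (hP s₀ t s))
    (summable_geometric_of_lt_one M.γ_pos.le M.γ_lt_one) fun t θ => ?_
  have hπ := isPolicy_softmaxPolicy θ
  rw [Real.norm_of_nonneg (mul_nonneg (pow_nonneg M.γ_pos.le t) (M.stateProb_nonneg hπ s₀ t s))]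
  exact mul_le_of_le_one_right (pow_nonneg M.γ_pos.le t) (M.stateProb_le_one hπ s₀ t s)

/-- The regularized state value function. -/
noncomputable def regStateValue (α : ℝ) (r ν π : S → A → ℝ) : S → ℝ :=
  M.stateValue π (regReward α r ν π)

theorem value_regReward {π : S → A → ℝ} (hπ : IsPolicy π) (α : ℝ) (r ν : S → A → ℝ) :
    M.value π (regReward α r ν π) = M.value π r - α * (M.visitKL π ν / (1 - M.γ)) := by
  rw [M.value_eq_sum_stateVisit hπ, M.value_eq_sum_stateVisit hπ, visitKL]
  simp only [sum_mul_regReward, mul_sub, Finset.sum_sub_distrib]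
  congr 1
  rw [Finset.mul_sum, Finset.sum_div, Finset.mul_sum]
  exact Finset.sum_congr rfl fun s _ => by ring

theorem regValue_eq [Nonempty A] (r : S → A → ℝ) (α : ℝ) (θk θ : S × A → ℝ) :
    M.regValue r α θk θ =
      M.value (softmaxPolicy θ) (regReward α r (softmaxPolicy θk) (softmaxPolicy θ)) := by
  rw [M.value_regReward (isPolicy_softmaxPolicy θ), regValue]

/-- The regularized advantage function, up to a function of the state. -/
noncomputable def regAdv (r : S → A → ℝ) (α : ℝ) (θk θ : S × A → ℝ) (p : S × A) : ℝ :=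
  regReward α r (softmaxPolicy θk) (softmaxPolicy θ) p.1 p.2
    + M.γ * M.next (M.regStateValue α r (softmaxPolicy θk) (softmaxPolicy θ)) p.1 p.2

/-- The policy gradient theorem for the regularized value. -/
theorem hasFDerivAt_regValue [Nonempty A] (r : S → A → ℝ) (α : ℝ) (θk θ : S × A → ℝ) :
    HasFDerivAt (M.regValue r α θk)
      ((1 / (1 - M.γ)) • ∑ s, M.stateVisit (softmaxPolicy θ) s •
        ∑ a, (softmaxPolicy θ s a * M.regAdv r α θk θ (s, a)) • score θ s a) θ := by
  set W := M.regStateValue α r (softmaxPolicy θk) (softmaxPolicy θ) with hW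
  -- `W` is frozen at `θ`. Its Bellman residual vanishes at `θ' = θ`, so the visitation measure need
  -- only be continuous and is never differentiated.
  have hfun : M.regValue r α θk = fun θ' => ∑ s, M.ρ s * W s + 1 / (1 - M.γ) *
      ∑ s, M.stateVisit (softmaxPolicy θ') s *
        (M.bellman (softmaxPolicy θ') (regReward α r (softmaxPolicy θk) (softmaxPolicy θ')) W s
          - W s) := by
    funext θ'
    rw [← M.value_sub (isPolicy_softmaxPolicy θ'), regValue_eq]; ring
  rw [hfun]
  refine HasFDerivAt.const_add _ ((HasFDerivAt.fun_sum fun s _ => ?_).const_mul _)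
  refine HasFDerivAt.mul_of_eq_zero (M.continuous_stateVisit_softmaxPolicy s).continuousAt ?_ ?_
  · refine HasFDerivAt.sub_const _ ?_
    simp only [bellman, regReward, Real.log_div (softmaxPolicy_pos _ _ _).ne'
      (softmaxPolicy_pos _ _ _).ne']
    have h : ∀ a, HasFDerivAt (fun θ' => softmaxPolicy θ' s a *
        (r s a - α * (Real.log (softmaxPolicy θ' s a) - Real.log (softmaxPolicy θk s a))
          + M.γ * M.next W s a))
        ((softmaxPolicy θ s a * M.regAdv r α θk θ (s, a)) • score θ s a
          - (α * softmaxPolicy θ s a) • score θ s a) θ := by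
      intro a
      have h1 := (((hasFDerivAt_log_softmaxPolicy θ s a).sub_const
        (Real.log (softmaxPolicy θk s a))).const_mul α).const_sub (r s a)
      have h2 := (hasFDerivAt_softmaxPolicy θ s a).mul (h1.add_const (M.γ * M.next W s a))
      refine h2.congr_fderiv ?_
      ext v
      simp only [regAdv, regReward, ← hW, Real.log_div (softmaxPolicy_pos _ _ _).ne'
        (softmaxPolicy_pos _ _ _).ne', _root_.add_apply,
        _root_.sub_apply, _root_.neg_apply,
        _root_.smul_apply, smul_eq_mul]
      ring
    -- The term produced by differentiating the logarithm drops out because the score has mean zero.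
    refine (HasFDerivAt.fun_sum fun a _ => h a).congr_fderiv ?_
    rw [Finset.sum_sub_distrib, sub_eq_self]
    ext v
    simp only [_root_.sum_apply, _root_.smul_apply, smul_eq_mul,
      mul_assoc, _root_.zero_apply]
    rw [← Finset.mul_sum, sum_softmaxPolicy_mul_score, mul_zero]
  · rw [hW, regStateValue, M.bellman_stateValue (isPolicy_softmaxPolicy θ), sub_self]

variable [DecidableEq A]

theorem score_mulVec [Nonempty A] (θ : S × A → ℝ) (s : S) (a : A) (v : S × A → ℝ) :
    gradVec (fun θ' => Real.log (softmaxPolicy θ' s a)) θ ⬝ᵥ v = score θ s a v := by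
  conv_rhs => rw [pi_eq_sum_univ' v, map_sum]
  simp only [dotProduct, gradVec, (hasFDerivAt_log_softmaxPolicy θ s a).fderiv, map_smul,
    smul_eq_mul, mul_comm]

theorem fisher_mulVec [Nonempty A] (θ v : S × A → ℝ) (p : S × A) :
    (M.fisher θ).mulVec v p = ∑ s, M.stateVisit (softmaxPolicy θ) s *
      ∑ a, softmaxPolicy θ s a * score θ s a (Pi.single p 1) * score θ s a v := by
  simp only [fisher, Matrix.sum_mulVec, Finset.sum_apply, Matrix.smul_mulVec,
    Matrix.vecMulVec_mulVec, score_mulVec, Pi.smul_apply, stateActionVisit_eq, Finset.mul_sum,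
    smul_eq_mul, MulOpposite.smul_eq_mul_unop, MulOpposite.unop_op]
  refine Finset.sum_congr rfl fun s _ => Finset.sum_congr rfl fun a _ => ?_
  rw [gradVec, (hasFDerivAt_log_softmaxPolicy θ s a).fderiv]
  ring

theorem dotProduct_fisher_mulVec [Nonempty A] (θ v : S × A → ℝ) :
    v ⬝ᵥ (M.fisher θ).mulVec v = ∑ s, M.stateVisit (softmaxPolicy θ) s *
      ∑ a, softmaxPolicy θ s a * score θ s a v ^ 2 := by
  simp only [fisher, Matrix.sum_mulVec, dotProduct_sum, Matrix.smul_mulVec,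
    Matrix.vecMulVec_mulVec, score_mulVec, stateActionVisit_eq, Finset.mul_sum,
    dotProduct_smul, smul_eq_mul]
  refine Finset.sum_congr rfl fun s _ => Finset.sum_congr rfl fun a _ => ?_
  rw [dotProduct_comm v, score_mulVec]
  simp only [MulOpposite.smul_eq_mul_unop, MulOpposite.unop_op]
  ring

/-- Compatible function approximation: the score is centred, so the advantage may be replaced by its
centred version, which is the score applied to the advantage. -/
theorem gradVec_regValue [Nonempty A] (r : S → A → ℝ) (α : ℝ) (θk θ : S × A → ℝ) :
    gradVec (M.regValue r α θk) θ =
      (M.fisher θ).mulVec ((1 / (1 - M.γ)) • M.regAdv r α θk θ) := by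
  funext p
  rw [Matrix.mulVec_smul, gradVec, (M.hasFDerivAt_regValue r α θk θ).fderiv, Pi.smul_apply,
    fisher_mulVec]
  simp only [_root_.smul_apply, _root_.sum_apply, smul_eq_mul]
  congr 1
  refine Finset.sum_congr rfl fun s _ => ?_
  congr 1
  have h := sum_softmaxPolicy_mul_score θ s (Pi.single p 1)
  have e : ∀ a, softmaxPolicy θ s a * score θ s a (Pi.single p 1) *
      score θ s a (M.regAdv r α θk θ) =
      softmaxPolicy θ s a * M.regAdv r α θk θ (s, a) * score θ s a (Pi.single p 1) -
      softmaxPolicy θ s a * score θ s a (Pi.single p 1) *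
        ∑ b, softmaxPolicy θ s b * M.regAdv r α θk θ (s, b) := fun a => by
    rw [score_apply θ s a (M.regAdv r α θk θ)]; ring
  simp only [e]
  rw [Finset.sum_sub_distrib, ← Finset.sum_mul, h, zero_mul, sub_zero]

/-- The natural gradient is the regularized advantage, up to a function of the state, at the
states that can be visited. -/
theorem exists_naturalGradient_eq [Nonempty A] (r : S → A → ℝ) (α : ℝ) (θk θ : S × A → ℝ) {s : S}
    (hs : M.Reach s) : ∃ c : ℝ, ∀ a,
      (moorePenrose (M.fisher θ)).mulVec (gradVec (M.regValue r α θk) θ) (s, a) =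
        1 / (1 - M.γ) * M.regAdv r α θk θ (s, a) + c := by
  set x := (1 / (1 - M.γ)) • M.regAdv r α θk θ with hx
  set y := (moorePenrose (M.fisher θ)).mulVec (gradVec (M.regValue r α θk) θ) - x with hy
  have hF := isMoorePenrose_moorePenrose (M.fisher_isHermitian θ)
  -- The gradient is `F x` and `F F† F = F`. The quadratic form of `F` at `y` is then a vanishing
  -- weighted sum of squared scores; positive weights force `score y = 0`, i.e. `y (s, ·)` is
  -- constant.
  have h0 : (M.fisher θ).mulVec y = 0 := by
    rw [hy, Matrix.mulVec_sub, M.gradVec_regValue, ← hx, Matrix.mulVec_mulVec, Matrix.mulVec_mulVec,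
      hF.mul_mul_self, sub_self]
  have hπ := isPolicy_softmaxPolicy θ
  have h1 := M.dotProduct_fisher_mulVec θ y
  rw [h0, dotProduct_zero] at h1
  have hin : ∀ s, 0 ≤ ∑ a, softmaxPolicy θ s a * score θ s a y ^ 2 := fun s =>
    Finset.sum_nonneg fun a _ => mul_nonneg (hπ.nonneg s a) (sq_nonneg _)
  have h2 := (Finset.sum_eq_zero_iff_of_nonneg fun s _ =>
    mul_nonneg (M.stateVisit_nonneg hπ s) (hin s)).1 h1.symm s (Finset.mem_univ s)
  have h3 := (mul_eq_zero.1 h2).resolve_left (hs.stateVisit_pos M hπ (softmaxPolicy_pos θ)).ne'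
  refine ⟨∑ b, softmaxPolicy θ s b * y (s, b), fun a => ?_⟩
  have h4 := (Finset.sum_eq_zero_iff_of_nonneg fun a _ =>
    mul_nonneg (hπ.nonneg s a) (sq_nonneg _)).1 h3 a (Finset.mem_univ a)
  have h5 := pow_eq_zero_iff two_ne_zero |>.1
    ((mul_eq_zero.1 h4).resolve_left (softmaxPolicy_pos θ s a).ne')
  rw [score_apply] at h5
  have h6 : y (s, a) = (moorePenrose (M.fisher θ)).mulVec (gradVec (M.regValue r α θk) θ) (s, a)
    - 1 / (1 - M.γ) * M.regAdv r α θk θ (s, a) := rfl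
  linarith

/-- With step size `(1 - γ) / α`, a natural policy gradient step is a soft policy iteration step. -/
theorem exists_innerLoop_succ_eq [Nonempty A] (r : S → A → ℝ) {α : ℝ} (hα : 0 < α)
    (θk : S × A → ℝ) (j : ℕ) {s : S} (hs : M.Reach s) : ∃ c : ℝ, ∀ a,
      M.innerLoop r θk α ((1 - M.γ) / α) (j + 1) (s, a) = θk (s, a) + (r s a + M.γ * M.next
        (M.regStateValue α r (softmaxPolicy θk)
          (softmaxPolicy (M.innerLoop r θk α ((1 - M.γ) / α) j))) s a) / α + c := by
  set θ := M.innerLoop r θk α ((1 - M.γ) / α) j with hθ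
  obtain ⟨c, hc⟩ := M.exists_naturalGradient_eq r α θk θ hs
  -- With this step size `-log π_θ` in the advantage cancels `θ`, leaving the anchor; the two
  -- log-normalizers depend on `s` only.
  refine ⟨(1 - M.γ) / α * c + Real.log (∑ a', Real.exp (θ (s, a')))
    - Real.log (∑ a', Real.exp (θk (s, a'))), fun a => ?_⟩
  rw [innerLoop, ← hθ, Pi.add_apply, Pi.smul_apply, hc, regAdv, regReward,
    Real.log_div (softmaxPolicy_pos _ _ _).ne' (softmaxPolicy_pos _ _ _).ne', log_softmaxPolicy,
    log_softmaxPolicy, smul_eq_mul]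
  have := M.one_sub_γ_pos.ne'
  have := hα.ne'
  field_simp
  ring

end CMDP

/-! ### Relative entropy -/

/-- The relative entropy dominates the squared Hellinger distance. -/
theorem sum_sq_sqrt_sub_sqrt_le_klVec {A : Type*} [Fintype A] {x y : A → ℝ} (hx : ∀ a, 0 ≤ x a)
    (hx1 : ∑ a, x a = 1) (hy : ∀ a, 0 < y a) (hy1 : ∑ a, y a = 1) :
    ∑ a, (√(x a) - √(y a)) ^ 2 ≤ klVec x y := by
  have h1 : ∑ a, (√(x a) - √(y a)) ^ 2 = ∑ a, (2 * x a - 2 * (√(x a) * √(y a))) := by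
    have e : ∀ a, (√(x a) - √(y a)) ^ 2 = 2 * x a - 2 * (√(x a) * √(y a)) + (y a - x a) := by
      intro a
      linear_combination Real.sq_sqrt (hx a) + Real.sq_sqrt (hy a).le
    simp only [e]
    rw [Finset.sum_add_distrib, Finset.sum_sub_distrib (fun a => y a), hx1, hy1, sub_self, add_zero]
  rw [h1, klVec]
  refine Finset.sum_le_sum fun a _ => ?_
  rcases (hx a).eq_or_lt with h0 | h0
  · simp [← h0]
  have hs : 0 < √(x a) := Real.sqrt_pos.2 h0
  have ht : 0 < √(y a) := Real.sqrt_pos.2 (hy a)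
  -- Prepares `log u ≤ u - 1` at `u = √(y/x)`.
  have h2 : Real.log (x a / y a) = -(2 * Real.log (√(y a) / √(x a))) := by
    rw [← Real.sqrt_div (hy a).le, Real.log_sqrt (div_pos (hy a) h0).le, ← inv_div, Real.log_inv]
    ring
  have h3 := Real.log_le_sub_one_of_pos (div_pos ht hs)
  have h4 : x a * (√(y a) / √(x a)) = √(x a) * √(y a) := by
    nth_rewrite 1 [← Real.sq_sqrt h0.le]
    field_simp
  rw [h2]
  nlinarith [mul_le_mul_of_nonneg_left h3 h0.le]

theorem klVec_nonneg {A : Type*} [Fintype A] {x y : A → ℝ} (hx : ∀ a, 0 ≤ x a)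
    (hx1 : ∑ a, x a = 1) (hy : ∀ a, 0 < y a) (hy1 : ∑ a, y a = 1) : 0 ≤ klVec x y :=
  (Finset.sum_nonneg fun _ _ => sq_nonneg _).trans
    (sum_sq_sqrt_sub_sqrt_le_klVec hx hx1 hy hy1)

/-- A form of Pinsker's inequality. -/
theorem sq_sum_abs_sub_le_four_mul_klVec {A : Type*} [Fintype A] {x y : A → ℝ}
    (hx : ∀ a, 0 ≤ x a) (hx1 : ∑ a, x a = 1) (hy : ∀ a, 0 < y a) (hy1 : ∑ a, y a = 1) :
    (∑ a, |x a - y a|) ^ 2 ≤ 4 * klVec x y := by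
  have e : ∀ a, |x a - y a| = |√(x a) - √(y a)| * (√(x a) + √(y a)) := fun a => by
    nth_rewrite 1 [← Real.sq_sqrt (hx a), ← Real.sq_sqrt (hy a).le]
    rw [sq_sub_sq, abs_mul, mul_comm,
      abs_of_nonneg (add_nonneg (Real.sqrt_nonneg _) (Real.sqrt_nonneg _))]
  -- Cauchy-Schwarz for `|x - y| = |√x - √y| (√x + √y)`; the second factor gives the constant 4,
  -- which suffices for the stated range of `α`.
  have h1 := Finset.sum_mul_sq_le_sq_mul_sq Finset.univ (fun a => |√(x a) - √(y a)|)
    fun a => √(x a) + √(y a)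
  simp only [sq_abs, ← e] at h1
  have h2 : ∑ a, (√(x a) + √(y a)) ^ 2 ≤ 4 :=
    calc ∑ a, (√(x a) + √(y a)) ^ 2 ≤ ∑ a, (2 * x a + 2 * y a) := by
          refine Finset.sum_le_sum fun a _ => ?_
          nlinarith [sq_nonneg (√(x a) - √(y a)), Real.sq_sqrt (hx a), Real.sq_sqrt (hy a).le]
      _ = 4 := by rw [Finset.sum_add_distrib, ← Finset.mul_sum, ← Finset.mul_sum, hx1, hy1]; norm_num
  have h3 := sum_sq_sqrt_sub_sqrt_le_klVec hx hx1 hy hy1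
  have h4 : 0 ≤ ∑ a, (√(x a) - √(y a)) ^ 2 := Finset.sum_nonneg fun _ _ => sq_nonneg _
  nlinarith

theorem klVec_self {A : Type*} [Fintype A] (x : A → ℝ) : klVec x x = 0 := by
  refine Finset.sum_eq_zero fun a _ => ?_
  by_cases h : x a = 0 <;> simp [h]

/-! ### Soft policy iteration -/

namespace CMDP

variable {S A : Type*} [Fintype S] [Fintype A] {n : ℕ} (M : CMDP S A n)

/-- The soft Bellman optimality operator with reference policy `ν`. -/
noncomputable def softBellman (α : ℝ) (r ν : S → A → ℝ) (W : S → ℝ) (s : S) : ℝ :=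
  α * Real.log (∑ a, ν s a * Real.exp ((r s a + M.γ * M.next W s a) / α))

/-- `softBellman` is `α` times the log-normalizer of the exponential reweighting of the anchor;
normalization removes `c`. -/
theorem log_softmaxPolicy_div [Nonempty A] {α : ℝ} (hα : 0 < α) (r : S → A → ℝ) (θk θ' : S × A → ℝ)
    (W : S → ℝ) {s : S} {c : ℝ}
    (h : ∀ a, θ' (s, a) = θk (s, a) + (r s a + M.γ * M.next W s a) / α + c) (a : A) :
    α * Real.log (softmaxPolicy θ' s a / softmaxPolicy θk s a) =
      r s a + M.γ * M.next W s a - M.softBellman α r (softmaxPolicy θk) W s := by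
  have hk : 0 < ∑ a, Real.exp (θk (s, a)) :=
    Finset.sum_pos (fun _ _ => Real.exp_pos _) Finset.univ_nonempty
  have hZ : 0 < ∑ a, softmaxPolicy θk s a * Real.exp ((r s a + M.γ * M.next W s a) / α) :=
    Finset.sum_pos (fun a _ => mul_pos (softmaxPolicy_pos θk s a) (Real.exp_pos _))
      Finset.univ_nonempty
  have h1 : ∑ a, Real.exp (θ' (s, a)) = (∑ a, Real.exp (θk (s, a))) *
      (∑ a, softmaxPolicy θk s a * Real.exp ((r s a + M.γ * M.next W s a) / α)) * Real.exp c := by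
    rw [Finset.mul_sum, Finset.sum_mul]
    refine Finset.sum_congr rfl fun a _ => ?_
    rw [h, Real.exp_add, Real.exp_add, softmaxPolicy]
    field_simp
  rw [Real.log_div (softmaxPolicy_pos _ _ _).ne' (softmaxPolicy_pos _ _ _).ne', log_softmaxPolicy,
    log_softmaxPolicy, h1, Real.log_mul (mul_pos hk hZ).ne' (Real.exp_pos c).ne',
    Real.log_mul hk.ne' hZ.ne', Real.log_exp, h, softBellman]
  field_simp
  ring

/-- The regularized Bellman operator of `π` in terms of the soft greedy policy `π_θ'`. -/
theorem bellman_regReward [Nonempty A] {α : ℝ} (hα : 0 < α) (r : S → A → ℝ) (θk θ' : S × A → ℝ)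
    (W : S → ℝ) {s : S} {c : ℝ}
    (h : ∀ a, θ' (s, a) = θk (s, a) + (r s a + M.γ * M.next W s a) / α + c)
    {π : S → A → ℝ} (hπ : IsPolicy π) :
    M.bellman π (regReward α r (softmaxPolicy θk) π) W s =
      M.softBellman α r (softmaxPolicy θk) W s - α * klVec (π s) (softmaxPolicy θ' s) := by
  -- The Gibbs variational identity, termwise. The comparison policy may vanish at some actions, so
  -- these are treated separately.
  have e : ∀ a, π s a * (regReward α r (softmaxPolicy θk) π s a + M.γ * M.next W s a) =
      π s a * M.softBellman α r (softmaxPolicy θk) W s -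
        α * (π s a * Real.log (π s a / softmaxPolicy θ' s a)) := by
    intro a
    rcases (hπ.nonneg s a).eq_or_lt with h0 | h0
    · simp [← h0]
    have h1 := M.log_softmaxPolicy_div hα r θk θ' W h a
    have hk := softmaxPolicy_pos θk s a
    have hk' := softmaxPolicy_pos θ' s a
    rw [Real.log_div hk'.ne' hk.ne'] at h1
    rw [regReward, Real.log_div h0.ne' hk.ne', Real.log_div h0.ne' hk'.ne']
    linear_combination (-π s a) * h1
  rw [bellman]
  simp only [e]
  rw [Finset.sum_sub_distrib, ← Finset.sum_mul, hπ.sum_eq_one, one_mul, klVec, Finset.mul_sum]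

theorem softBellman_mono [Nonempty A] {α : ℝ} (hα : 0 < α) (r : S → A → ℝ) (θk : S × A → ℝ)
    {W W' : S → ℝ} (h : ∀ s, M.Reach s → W s ≤ W' s) {s : S} (hs : M.Reach s) :
    M.softBellman α r (softmaxPolicy θk) W s ≤ M.softBellman α r (softmaxPolicy θk) W' s := by
  refine mul_le_mul_of_nonneg_left (Real.log_le_log
    (Finset.sum_pos (fun a _ => mul_pos (softmaxPolicy_pos θk s a) (Real.exp_pos _))
      Finset.univ_nonempty) (Finset.sum_le_sum fun a _ => ?_)) hα.le
  refine mul_le_mul_of_nonneg_left (Real.exp_le_exp.2 ?_) (softmaxPolicy_pos θk s a).le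
  have := mul_le_mul_of_nonneg_left (hs.next_mono a h) M.γ_pos.le
  gcongr

theorem next_add_const (W : S → ℝ) (c : ℝ) (s : S) (a : A) :
    M.next (fun s => W s + c) s a = M.next W s a + c := by
  simp only [next, mul_add, Finset.sum_add_distrib, ← Finset.sum_mul, M.P_sum, one_mul]

/-- Together with monotonicity, this discount of constants replaces a sup-norm contraction estimate.
-/
theorem softBellman_add_const [Nonempty A] {α : ℝ} (hα : 0 < α) (r : S → A → ℝ) (θk : S × A → ℝ)
    (W : S → ℝ) (c : ℝ) (s : S) : M.softBellman α r (softmaxPolicy θk) (fun s => W s + c) s =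
      M.softBellman α r (softmaxPolicy θk) W s + M.γ * c := by
  have hZ : 0 < ∑ a, softmaxPolicy θk s a * Real.exp ((r s a + M.γ * M.next W s a) / α) :=
    Finset.sum_pos (fun a _ => mul_pos (softmaxPolicy_pos θk s a) (Real.exp_pos _))
      Finset.univ_nonempty
  have e : ∀ a, softmaxPolicy θk s a *
      Real.exp ((r s a + M.γ * M.next (fun s => W s + c) s a) / α) =
      softmaxPolicy θk s a * Real.exp ((r s a + M.γ * M.next W s a) / α) *
        Real.exp (M.γ * c / α) := fun a => by
    rw [next_add_const, mul_assoc, ← Real.exp_add]; congr 2; ring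
  simp only [softBellman, e]
  rw [← Finset.sum_mul, Real.log_mul hZ.ne' (Real.exp_pos _).ne', Real.log_exp]
  field_simp

theorem softBellman_const_le [Nonempty A] {α : ℝ} (hα : 0 < α) {r : S → A → ℝ} {B : ℝ}
    (hr : ∀ s a, r s a ≤ B) (θk : S × A → ℝ) (s : S) :
    M.softBellman α r (softmaxPolicy θk) (fun _ => B / (1 - M.γ)) s ≤ B / (1 - M.γ) := by
  have hZ : 0 < ∑ a, softmaxPolicy θk s a *
      Real.exp ((r s a + M.γ * M.next (fun _ => B / (1 - M.γ)) s a) / α) :=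
    Finset.sum_pos (fun a _ => mul_pos (softmaxPolicy_pos θk s a) (Real.exp_pos _))
      Finset.univ_nonempty
  have h : ∑ a, softmaxPolicy θk s a *
      Real.exp ((r s a + M.γ * M.next (fun _ => B / (1 - M.γ)) s a) / α) ≤
        Real.exp (B / (1 - M.γ) / α) := by
    refine (isPolicy_softmaxPolicy θk).sum_mul_le (r := fun s a =>
      Real.exp ((r s a + M.γ * M.next (fun _ => B / (1 - M.γ)) s a) / α)) (fun s a => ?_) s
    rw [Real.exp_le_exp, next_const]
    refine div_le_div_of_nonneg_right ?_ hα.le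
    have h1 : B / (1 - M.γ) = B + M.γ * (B / (1 - M.γ)) := by
      have := M.one_sub_γ_pos.ne'
      field_simp; ring
    rw [h1]
    have := hr s a
    rw [← h1]; linarith
  have h2 := (Real.log_le_iff_le_exp hZ).2 h
  rw [softBellman, mul_comm]
  exact (le_div_iff₀ hα).1 h2

variable [DecidableEq S] [DecidableEq A]

section InnerLoop

variable [Nonempty A] {α : ℝ} (hα : 0 < α) {r : S → A → ℝ} {B : ℝ} (hr0 : ∀ s a, 0 ≤ r s a)
  (hr : ∀ s a, r s a ≤ B) (θk : S × A → ℝ)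

/-- The regularized state value function of the `j`-th iterate of the inner loop with step size
`(1 - γ) / α`. -/
noncomputable def innerValue (α : ℝ) (r : S → A → ℝ) (θk : S × A → ℝ) (j : ℕ) : S → ℝ :=
  M.regStateValue α r (softmaxPolicy θk) (softmaxPolicy (M.innerLoop r θk α ((1 - M.γ) / α) j))

theorem sum_ρ_mul_innerValue (r : S → A → ℝ) (α : ℝ) (θk : S × A → ℝ) (j : ℕ) :
    ∑ s, M.ρ s * M.innerValue α r θk j s =
      M.regValue r α θk (M.innerLoop r θk α ((1 - M.γ) / α) j) := by
  rw [regValue_eq]; rfl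

include hα

/-- By the Bellman equation the gap is `α` times the relative entropy to the next iterate. -/
theorem innerValue_le_softBellman (j : ℕ) {s : S} (hs : M.Reach s) :
    M.innerValue α r θk j s ≤
      M.softBellman α r (softmaxPolicy θk) (M.innerValue α r θk j) s := by
  obtain ⟨c, hc⟩ := M.exists_innerLoop_succ_eq r hα θk j hs
  have hπ := isPolicy_softmaxPolicy (M.innerLoop r θk α ((1 - M.γ) / α) j)
  have hπ' := isPolicy_softmaxPolicy (M.innerLoop r θk α ((1 - M.γ) / α) (j + 1))
  have h := M.bellman_regReward hα r θk _ _ hc hπ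
  have h' := congrFun (M.bellman_stateValue hπ (regReward α r (softmaxPolicy θk)
    (softmaxPolicy (M.innerLoop r θk α ((1 - M.γ) / α) j)))) s
  rw [regStateValue, h', ← regStateValue] at h
  have hkl := klVec_nonneg (hπ.nonneg s) (hπ.sum_eq_one s) (softmaxPolicy_pos _ s)
    (hπ'.sum_eq_one s)
  rw [innerValue, h]
  exact sub_le_self _ (mul_nonneg hα.le hkl)

/-- Soft policy improvement. -/
theorem softBellman_le_innerValue_succ (j : ℕ) {s : S} (hs : M.Reach s) :
    M.softBellman α r (softmaxPolicy θk) (M.innerValue α r θk j) s ≤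
      M.innerValue α r θk (j + 1) s := by
  set π' := softmaxPolicy (M.innerLoop r θk α ((1 - M.γ) / α) (j + 1)) with hπ'
  have hp : IsPolicy π' := isPolicy_softmaxPolicy _
  -- The next iterate is soft greedy for the current value, so its relative entropy term is zero.
  have hb : ∀ s, M.Reach s → M.bellman π' (regReward α r (softmaxPolicy θk) π')
      (M.innerValue α r θk j) s = M.softBellman α r (softmaxPolicy θk) (M.innerValue α r θk j) s := by
    intro s hs
    obtain ⟨c, hc⟩ := M.exists_innerLoop_succ_eq r hα θk j hs
    have h := M.bellman_regReward hα r θk _ _ hc hp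
    rw [← hπ', klVec_self, mul_zero, sub_zero] at h
    exact h
  have h1 : ∀ s, M.Reach s → M.innerValue α r θk j s ≤ M.innerValue α r θk (j + 1) s := fun s hs =>
    M.le_stateValue hp _ _ (fun s hs => by
      rw [hb s hs]; exact M.innerValue_le_softBellman hα θk j hs) hs
  have h2 : M.bellman π' (regReward α r (softmaxPolicy θk) π') (M.innerValue α r θk (j + 1)) =
    M.innerValue α r θk (j + 1) := M.bellman_stateValue hp _
  rw [← hb s hs, ← h2]
  refine Finset.sum_le_sum fun a _ => mul_le_mul_of_nonneg_left ?_ (hp.nonneg s a)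
  have := mul_le_mul_of_nonneg_left (hs.next_mono a h1) M.γ_pos.le
  exact add_le_add_right this _

-- At the anchor the penalty vanishes, leaving the value of a nonnegative reward.
omit hα in
include hr0 in
theorem innerValue_zero_nonneg (α : ℝ) (s : S) : 0 ≤ M.innerValue α r θk 0 s := by
  have hp := isPolicy_softmaxPolicy θk
  refine M.stateValue_nonneg hp (fun s => ?_) s
  rw [innerLoop, sum_mul_regReward, klVec_self, mul_zero, sub_zero]
  exact hp.sum_mul_nonneg hr0 s

include hr in
theorem innerValue_le (j : ℕ) (s : S) : M.innerValue α r θk j s ≤ B / (1 - M.γ) := by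
  have hp := isPolicy_softmaxPolicy (M.innerLoop r θk α ((1 - M.γ) / α) j)
  refine M.stateValue_le hp (fun s => ?_) s
  rw [sum_mul_regReward]
  have hkl := klVec_nonneg (hp.nonneg s) (hp.sum_eq_one s) (softmaxPolicy_pos θk s)
    ((isPolicy_softmaxPolicy θk).sum_eq_one s)
  exact (sub_le_self _ (mul_nonneg hα.le hkl)).trans (hp.sum_mul_le hr s)

include hr0 hr in
/-- The soft Bellman residual decreases geometrically along the inner loop. -/
theorem softBellman_innerValue_le (j : ℕ) {s : S} (hs : M.Reach s) :
    M.softBellman α r (softmaxPolicy θk) (M.innerValue α r θk j) s ≤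
      M.innerValue α r θk j s + M.γ ^ j * (B / (1 - M.γ)) := by
  set T := M.softBellman α r (softmaxPolicy θk) with hT
  -- Soft value iteration from a constant upper bound. It decreases, dominates the inner value at
  -- every index, and at index `j` exceeds it by at most `γ ^ j * (B / (1 - γ))`; no fixed point is
  -- needed.
  set U : ℕ → S → ℝ := fun i => T^[i] fun _ => B / (1 - M.γ) with hU
  have hUs : ∀ i, U (i + 1) = T (U i) := fun i => Function.iterate_succ_apply' T i _
  have hanti : ∀ i s, M.Reach s → U (i + 1) s ≤ U i s := by
    intro i
    induction i with
    | zero => intro s _; exact M.softBellman_const_le hα hr θk s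
    | succ i ih =>
      intro s hs
      rw [hUs (i + 1), hUs i]
      exact M.softBellman_mono hα r θk (fun s hs => by rw [← hUs i]; exact ih s hs) hs
  have hle : ∀ i s, M.Reach s → M.innerValue α r θk j s ≤ U i s := by
    intro i
    induction i with
    | zero => intro s _; exact M.innerValue_le hα hr θk j s
    | succ i ih =>
      intro s hs
      rw [hUs]
      exact (M.innerValue_le_softBellman hα θk j hs).trans (M.softBellman_mono hα r θk ih hs)
  have hge : ∀ j s, M.Reach s → U j s ≤ M.innerValue α r θk j s + M.γ ^ j * (B / (1 - M.γ)) := by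
    intro j
    induction j with
    | zero =>
      intro s _
      rw [pow_zero, one_mul]
      exact le_add_of_nonneg_left (M.innerValue_zero_nonneg hr0 θk α s)
    | succ j ih =>
      intro s hs
      rw [hUs]
      refine (M.softBellman_mono hα r θk ih hs).trans ?_
      rw [M.softBellman_add_const hα, pow_succ']
      linarith [M.softBellman_le_innerValue_succ (r := r) hα θk j hs]
  calc T (M.innerValue α r θk j) s ≤ T (U j) s := M.softBellman_mono hα r θk (hle j) hs
    _ ≤ U j s := by rw [← hUs]; exact hanti j s hs
    _ ≤ _ := hge j s hs

include hr0 hr in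
/-- The approximate three-point inequality for the inner loop. -/
theorem value_sub_visitKL_add_visitKL_le (hB : 0 ≤ B) {π : S → A → ℝ} (hπ : IsPolicy π) (t : ℕ) :
    M.value π r - α * (M.visitKL π (softmaxPolicy θk) / (1 - M.γ)) + α * (M.visitKL π
        (softmaxPolicy (M.innerLoop r θk α ((1 - M.γ) / α) t)) / (1 - M.γ)) ≤
      M.regValue r α θk (M.innerLoop r θk α ((1 - M.γ) / α) t)
        + M.γ ^ (t - 1) * (B / (1 - M.γ) ^ 2) := by
  have hγ := M.one_sub_γ_pos
  cases t with
  | zero =>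
    -- Without steps the two divergences cancel, and `t - 1 = 0` leaves an error term exceeding any
    -- value.
    have h1 := M.value_le hπ hr
    have h2 : 0 ≤ M.regValue r α θk (M.innerLoop r θk α ((1 - M.γ) / α) 0) := by
      rw [← sum_ρ_mul_innerValue]
      exact Finset.sum_nonneg fun s _ =>
        mul_nonneg (M.ρ_nonneg s) (M.innerValue_zero_nonneg hr0 θk α s)
    have h3 : B / (1 - M.γ) ≤ B / (1 - M.γ) ^ 2 := by
      refine div_le_div_of_nonneg_left hB (pow_pos hγ 2) ?_
      nlinarith [M.γ_pos, M.γ_lt_one]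
    simp only [innerLoop] at *
    simp only [Nat.zero_sub, pow_zero, one_mul]
    linarith
  | succ j =>
    set W := M.innerValue α r θk j with hW
    set π' := softmaxPolicy (M.innerLoop r θk α ((1 - M.γ) / α) (j + 1)) with hπ'
    have h1 := M.value_sub hπ (regReward α r (softmaxPolicy θk) π) W
    rw [M.value_regReward hπ] at h1
    -- The residual of `π` is the soft residual minus `α` times its divergence from the new policy:
    -- the third point of the inequality.
    have h2 : ∑ s, M.stateVisit π s * (M.bellman π (regReward α r (softmaxPolicy θk) π) W s - W s) =
        ∑ s, M.stateVisit π s * (M.softBellman α r (softmaxPolicy θk) W s - W s)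
          - α * M.visitKL π π' := by
      rw [visitKL, Finset.mul_sum, ← Finset.sum_sub_distrib]
      refine Finset.sum_congr rfl fun s _ => ?_
      by_cases h0 : M.stateVisit π s = 0
      · simp [h0]
      obtain ⟨c, hc⟩ :=
        M.exists_innerLoop_succ_eq r hα θk j (M.reach_of_stateVisit_ne_zero h0)
      rw [M.bellman_regReward hα r θk _ W hc hπ]
      ring
    have h3 : ∑ s, M.stateVisit π s * (M.softBellman α r (softmaxPolicy θk) W s - W s) ≤
        M.γ ^ j * (B / (1 - M.γ)) :=
      M.sum_stateVisit_mul_le hπ fun s hs => by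
        linarith [M.softBellman_innerValue_le hα hr0 hr θk j hs]
    have h4 : ∑ s, M.ρ s * W s ≤
        M.regValue r α θk (M.innerLoop r θk α ((1 - M.γ) / α) (j + 1)) := by
      rw [← sum_ρ_mul_innerValue]
      refine Finset.sum_le_sum fun s _ => ?_
      rcases (M.ρ_nonneg s).eq_or_lt with h0 | h0
      · simp [← h0]
      · exact mul_le_mul_of_nonneg_left ((M.innerValue_le_softBellman hα θk j (.init h0)).trans
          (M.softBellman_le_innerValue_succ hα θk j (.init h0))) h0.le
    have h5 := mul_le_mul_of_nonneg_left h3 (one_div_pos.2 hγ).le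
    have h6 : 1 / (1 - M.γ) * (M.γ ^ j * (B / (1 - M.γ))) = M.γ ^ j * (B / (1 - M.γ) ^ 2) := by
      field_simp
    rw [h2, mul_sub] at h1
    have h7 : 1 / (1 - M.γ) * (α * M.visitKL π π') = α * (M.visitKL π π' / (1 - M.γ)) := by ring
    rw [Nat.add_sub_cancel]
    linarith

end InnerLoop

end CMDP

/-! ### Strong duality -/

namespace CMDP

variable {S A : Type*} [Fintype S] [Fintype A] {n : ℕ} (M : CMDP S A n)

/-- The polytope of state-action visitation distributions. -/
def flowPolytope : Set (S → A → ℝ) :=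
  {x | (∀ s a, 0 ≤ x s a) ∧
    ∀ s, ∑ a, x s a = (1 - M.γ) * M.ρ s + M.γ * ∑ s', ∑ a, x s' a * M.P s' a s}

theorem convex_flowPolytope : Convex ℝ M.flowPolytope := by
  intro x hx y hy c d hc hd hcd
  refine ⟨fun s a => add_nonneg (mul_nonneg hc (hx.1 s a)) (mul_nonneg hd (hy.1 s a)),
    fun s => ?_⟩
  have e1 : ∑ a, (c • x + d • y) s a = c * ∑ a, x s a + d * ∑ a, y s a := by
    simp only [Pi.add_apply, Pi.smul_apply, smul_eq_mul, Finset.sum_add_distrib, Finset.mul_sum]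
  have e2 : ∑ s', ∑ a, (c • x + d • y) s' a * M.P s' a s =
      c * ∑ s', ∑ a, x s' a * M.P s' a s + d * ∑ s', ∑ a, y s' a * M.P s' a s := by
    simp only [Pi.add_apply, Pi.smul_apply, smul_eq_mul, add_mul, Finset.sum_add_distrib,
      Finset.mul_sum, mul_assoc]
  rw [e1, e2, hx.2 s, hy.2 s]
  linear_combination (1 - M.γ) * M.ρ s * hcd

/-- The flow equation in weak form. -/
theorem sum_flow_mul {x : S → A → ℝ} (hx : x ∈ M.flowPolytope) (W : S → ℝ) :
    ∑ s, ∑ a, x s a * (W s - M.γ * M.next W s a) = (1 - M.γ) * ∑ s, M.ρ s * W s := by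
  have h1 : ∑ s, ∑ a, x s a * W s = (1 - M.γ) * ∑ s, M.ρ s * W s +
      M.γ * ∑ s', ∑ a, x s' a * M.next W s' a := by
    have e : ∀ s, ∑ a, x s a * W s = (1 - M.γ) * (M.ρ s * W s) +
        M.γ * ∑ s', ∑ a, x s' a * (M.P s' a s * W s) := fun s => by
      rw [← Finset.sum_mul, hx.2 s, add_mul, mul_assoc, mul_assoc, Finset.sum_mul]
      simp only [Finset.sum_mul, mul_assoc]
    simp only [e]
    rw [Finset.sum_add_distrib, ← Finset.mul_sum, ← Finset.mul_sum, Finset.sum_comm]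
    congr 2
    refine Finset.sum_congr rfl fun s' _ => ?_
    rw [Finset.sum_comm]
    simp only [next, Finset.mul_sum]
  simp only [mul_sub, Finset.sum_sub_distrib]
  rw [h1, Finset.mul_sum]
  simp only [Finset.mul_sum, mul_left_comm M.γ, add_sub_cancel_right]

theorem isCompact_flowPolytope : IsCompact M.flowPolytope := by
  have hcl : IsClosed M.flowPolytope := by
    have : M.flowPolytope = (⋂ s, ⋂ a, {x | 0 ≤ x s a}) ∩ ⋂ s, {x | ∑ a, x s a =
        (1 - M.γ) * M.ρ s + M.γ * ∑ s', ∑ a, x s' a * M.P s' a s} := by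
      ext x; simp [flowPolytope]
    rw [this]
    exact (isClosed_iInter fun s => isClosed_iInter fun a =>
      isClosed_le continuous_const (by fun_prop)).inter
        (isClosed_iInter fun s => isClosed_eq (by fun_prop) (by fun_prop))
  refine (isCompact_Icc (a := (0 : S → A → ℝ)) (b := fun _ _ => 1)).of_isClosed_subset hcl ?_
  intro x hx
  refine ⟨fun s a => hx.1 s a, fun s a => ?_⟩
  have h := M.sum_flow_mul hx fun _ => 1
  simp only [next_const, mul_one, M.ρ_sum, ← Finset.sum_mul] at h
  have h1 : ∑ s, ∑ a, x s a = 1 := by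
    have := M.one_sub_γ_pos
    exact mul_right_cancel₀ this.ne' (by rw [h, one_mul])
  calc x s a ≤ ∑ a, x s a := Finset.single_le_sum (fun a _ => hx.1 s a) (Finset.mem_univ a)
    _ ≤ ∑ s, ∑ a, x s a := Finset.single_le_sum (f := fun s => ∑ a, x s a)
        (fun s _ => Finset.sum_nonneg fun a _ => hx.1 s a) (Finset.mem_univ s)
    _ = 1 := h1

variable [DecidableEq S]

theorem visit_mem_flowPolytope {π : S → A → ℝ} (hπ : IsPolicy π) :
    (fun s a => M.stateVisit π s * π s a) ∈ M.flowPolytope := by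
  refine ⟨fun s a => mul_nonneg (M.stateVisit_nonneg hπ s) (hπ.nonneg s a), fun s => ?_⟩
  rw [← Finset.mul_sum, hπ.sum_eq_one, mul_one, M.stateVisit_flow hπ s]
  simp only [Finset.mul_sum, mul_assoc]

/-- Every point of the flow polytope is the visitation distribution of a policy. -/
theorem exists_value_eq [Nonempty A] {x : S → A → ℝ} (hx : x ∈ M.flowPolytope) :
    ∃ π : S → A → ℝ, IsPolicy π ∧
      ∀ r, M.value π r = 1 / (1 - M.γ) * ∑ s, ∑ a, x s a * r s a := by
  have hcard : (Fintype.card A : ℝ) ≠ 0 := Nat.cast_ne_zero.2 Fintype.card_ne_zero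
  have hnn : ∀ s, 0 ≤ ∑ b, x s b := fun s => Finset.sum_nonneg fun b _ => hx.1 s b
  -- Conditional action probabilities; the uniform choice at massless states is immaterial since `x`
  -- vanishes there.
  let π : S → A → ℝ := fun s a =>
    if ∑ b, x s b = 0 then 1 / (Fintype.card A : ℝ) else x s a / ∑ b, x s b
  have hπ : IsPolicy π := by
    refine ⟨fun s a => ?_, fun s => ?_⟩
    · simp only [π]
      split_ifs
      · positivity
      · exact div_nonneg (hx.1 s a) (hnn s)
    · by_cases h : ∑ b, x s b = 0
      · simp [π, h, hcard]
      · simp only [π, h, if_false]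
        rw [← Finset.sum_div, div_self h]
  have hxπ : ∀ s a, x s a = (∑ b, x s b) * π s a := by
    intro s a
    by_cases h : ∑ b, x s b = 0
    · rw [h, zero_mul]
      exact (Finset.sum_eq_zero_iff_of_nonneg fun b _ => hx.1 s b).1 h a (Finset.mem_univ a)
    · simp only [π, h, if_false]
      rw [mul_div_cancel₀ _ h]
  refine ⟨π, hπ, fun r => ?_⟩
  -- Testing the flow equation with the value function turns it into the integral of the reward, by
  -- the Bellman equation.
  have h1 := M.sum_flow_mul hx (M.stateValue π r)
  have h2 : ∀ s, ∑ a, x s a * (M.stateValue π r s - M.γ * M.next (M.stateValue π r) s a) =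
      ∑ a, x s a * r s a := by
    intro s
    have h3 : M.stateValue π r s = ∑ a, π s a * (r s a + M.γ * M.next (M.stateValue π r) s a) :=
      (congrFun (M.bellman_stateValue hπ r) s).symm
    have h4 : ∑ a, x s a * M.stateValue π r s =
        ∑ a, x s a * (r s a + M.γ * M.next (M.stateValue π r) s a) := by
      rw [← Finset.sum_mul, h3, Finset.mul_sum]
      exact Finset.sum_congr rfl fun a _ => by
        rw [hxπ s a, mul_assoc]
    simp only [mul_add, Finset.sum_add_distrib] at h4
    simp only [mul_sub, Finset.sum_sub_distrib]
    rw [h4]; ring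
  simp only [h2] at h1
  rw [h1, value, ← mul_assoc, one_div_mul_cancel M.one_sub_γ_pos.ne', one_mul]

/-- The vector of values, as a function of the visitation distribution. -/
noncomputable def flowValue : (S → A → ℝ) →ₗ[ℝ] (Fin (n + 1) → ℝ) where
  toFun x i := 1 / (1 - M.γ) * ∑ s, ∑ a, x s a * M.r i s a
  map_add' x y := by
    funext i
    simp only [Pi.add_apply, add_mul, Finset.sum_add_distrib, mul_add]
  map_smul' c x := by
    funext i
    simp only [Pi.smul_apply, smul_eq_mul, RingHom.id_apply, mul_assoc, ← Finset.mul_sum]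
    ring

theorem V_eq_flowValue {π : S → A → ℝ} (hπ : IsPolicy π) (i : Fin (n + 1)) :
    M.V π i = M.flowValue (fun s a => M.stateVisit π s * π s a) i := by
  rw [V, M.value_eq_sum_stateVisit hπ]
  simp only [flowValue, LinearMap.coe_mk, AddHom.coe_mk, mul_assoc, Finset.mul_sum]

/-- The dual function takes values arbitrarily close to the optimal value. -/
theorem exists_dualFunction_le [Nonempty A] {πs : S → A → ℝ} (hπs : M.IsOptimal πs) {ε : ℝ}
    (hε : 0 < ε) :
    ∃ lam : Fin n → ℝ, (∀ i, 0 ≤ lam i) ∧ M.dualFunction lam ≤ M.V πs 0 + ε := by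
  -- By optimality no attainable value vector dominates `q`; the slack `ε` makes the orthant
  -- disjoint from the attainable set.
  let q : Fin (n + 1) → ℝ := Fin.cons (M.V πs 0 + ε) M.b
  have hcomp : IsCompact (M.flowValue '' M.flowPolytope) :=
    M.isCompact_flowPolytope.image M.flowValue.continuous_of_finiteDimensional
  have hdisj : Disjoint (M.flowValue '' M.flowPolytope) (Set.Ici q) := by
    rw [Set.disjoint_left]
    rintro _ ⟨x, hx, rfl⟩ hq
    obtain ⟨π, hπ, hv⟩ := M.exists_value_eq hx
    have hV : ∀ i, M.V π i = M.flowValue x i := fun i => hv (M.r i)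
    have hle := hπs.le_of_feasible π hπ fun i => by
      rw [hV]; simpa [q] using hq i.succ
    have h0 : M.V πs 0 + ε ≤ M.V π 0 := by rw [hV]; simpa [q] using hq 0
    linarith
  obtain ⟨f, u, v, hfu, huv, hfv⟩ := geometric_hahn_banach_compact_closed
    (M.convex_flowPolytope.linear_image M.flowValue) hcomp (convex_Ici q) isClosed_Ici hdisj
  set c : Fin (n + 1) → ℝ := fun i => f (Pi.single i 1) with hc
  have hf : ∀ y, f y = ∑ i, c i * y i := fun y => by
    conv_lhs => rw [pi_eq_sum_univ' y, map_sum]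
    simp only [map_smul, smul_eq_mul, mul_comm, hc]
  have hc0 : ∀ i, 0 ≤ c i := by
    intro i
    by_contra! hneg
    -- The multiple at which `f` would equal `v`, against strict separation.
    have hk : 0 ≤ (f q - v) / (-c i) :=
      div_nonneg (sub_nonneg.2 (hfv q (Set.mem_Ici.2 le_rfl)).le) (by linarith)
    have h := hfv (q + ((f q - v) / (-c i)) • Pi.single i 1) (by
      rw [Set.mem_Ici]
      refine le_add_of_nonneg_right (smul_nonneg hk ?_)
      exact Pi.single_nonneg.2 zero_le_one)
    rw [map_add, map_smul, smul_eq_mul] at h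
    change v < f q + (f q - v) / (-c i) * c i at h
    have : (f q - v) / (-c i) * c i = -(f q - v) := by
      rw [div_neg, neg_mul, div_mul_cancel₀ _ hneg.ne]
    linarith
  have hlt : ∀ π, IsPolicy π → ∑ i, c i * M.V π i < ∑ i, c i * q i := by
    intro π hπ
    rw [← hf q]
    refine lt_of_eq_of_lt ?_ ((hfu _ ⟨_, M.visit_mem_flowPolytope hπ, rfl⟩).trans
      (huv.trans (hfv q (Set.mem_Ici.2 le_rfl))))
    rw [hf]
    exact Finset.sum_congr rfl fun i _ => by rw [M.V_eq_flowValue hπ]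
  simp only [Fin.sum_univ_succ, q, Fin.cons_zero, Fin.cons_succ] at hlt
  -- Otherwise the feasible policy `πs` itself contradicts strict separation.
  have hpos : 0 < c 0 := by
    refine (hc0 0).lt_of_ne' fun h0 => ?_
    have h := hlt πs hπs.isPolicy
    rw [h0, zero_mul, zero_mul, zero_add, zero_add] at h
    exact h.not_ge (Finset.sum_le_sum fun i _ =>
      mul_le_mul_of_nonneg_left (hπs.feasible i) (hc0 _))
  refine ⟨fun i => c i.succ / c 0, fun i => div_nonneg (hc0 _) hpos.le, ?_⟩
  have : Nonempty {π : S → A → ℝ // IsPolicy π} := ⟨⟨πs, hπs.isPolicy⟩⟩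
  refine ciSup_le fun π => ?_
  have h := hlt π.1 π.2
  have h1 : c 0 * M.lagrangian π.1 (fun i : Fin n => c i.succ / c 0) =
      c 0 * M.V π.1 0 + ∑ i : Fin n, c i.succ * M.V π.1 i.succ - ∑ i : Fin n, c i.succ * M.b i := by
    rw [lagrangian, mul_add, Finset.mul_sum, add_sub_assoc, ← Finset.sum_sub_distrib]
    congr 1
    refine Finset.sum_congr rfl fun i _ => ?_
    field_simp
  refine le_of_mul_le_mul_left ?_ hpos
  rw [h1]; linarith

/-- An optimal policy and an optimal dual variable form a saddle point of the Lagrangian. -/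
theorem lagrangian_le_of_isDualOptimal [Nonempty A] {πs : S → A → ℝ} (hπs : M.IsOptimal πs)
    {lam : Fin n → ℝ} (hlam : M.IsDualOptimal lam) {π : S → A → ℝ} (hπ : IsPolicy π) :
    M.lagrangian π lam ≤ M.V πs 0 := by
  refine le_of_forall_pos_le_add fun ε hε => ?_
  obtain ⟨lam', h0, h1⟩ := M.exists_dualFunction_le hπs hε
  refine le_trans ?_ ((hlam.dual_le lam' h0).trans h1)
  refine le_ciSup (f := fun π : {π : S → A → ℝ // IsPolicy π} => M.lagrangian π.1 lam) ?_ ⟨π, hπ⟩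
  -- The real supremum is meaningful only for a bounded family.
  refine ⟨1 / (1 - M.γ) + ∑ i, lam i * (1 / (1 - M.γ)), ?_⟩
  rintro _ ⟨π, rfl⟩
  refine add_le_add (M.V_le π.2 0) (Finset.sum_le_sum fun i _ =>
    mul_le_mul_of_nonneg_left ?_ (hlam.nonneg i))
  linarith [M.V_le π.2 i.succ, M.b_nonneg i]

end CMDP

/-! ### Convergence of ARNPG-EPD -/

/-- The drift-plus-penalty analysis of the dual update of ARNPG-EPD: `g k` are the constraint
violations, `D k` the proximal terms and `Φ k` the distances to the optimal policy. -/
theorem sum_range_sub_le_of_drift {n : ℕ} {η' : ℝ} (hη' : 0 < η') {g lam : ℕ → Fin n → ℝ}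
    (h0 : ∀ i, lam 0 i = max (η' * -g 0 i) 0)
    (hs : ∀ k i, lam (k + 1) i = max (η' * -g (k + 1) i) (lam k i + η' * g (k + 1) i))
    {v D Φ : ℕ → ℝ} {vs e : ℝ} {K : ℕ}
    (hD : ∀ k < K, η' / 2 * ∑ i, (g k i - g (k + 1) i) ^ 2 ≤ D k)
    (hstep : ∀ k < K, vs - v (k + 1) ≤ -∑ i, (lam k i + η' * g k i) * g (k + 1) i - D k
      + (Φ k - Φ (k + 1)) + e) :
    ∑ k ∈ Finset.range K, (vs - v (k + 1)) ≤ η' / 2 * ∑ i, g K i ^ 2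
      - 1 / (2 * η') * ∑ i, lam K i ^ 2 + (Φ 0 - Φ K) + K * e := by
  have hind : ∀ k ≤ K, ∑ k ∈ Finset.range k, (vs - v (k + 1)) ≤
      (η' / 2 * ∑ i, g k i ^ 2 - 1 / (2 * η') * ∑ i, lam k i ^ 2) -
      (η' / 2 * ∑ i, g 0 i ^ 2 - 1 / (2 * η') * ∑ i, lam 0 i ^ 2) + (Φ 0 - Φ k) + k * e := by
    intro k
    induction k with
    | zero => intro _; simp
    | succ k ih =>
      intro hk
      have h1 := ih (by omega)
      have h2 := hstep k hk
      have h3 := hD k hk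
      -- Uses `-2 g_k g_{k+1} = (g_k - g_{k+1})² - g_k² - g_{k+1}²` and the dual drift `h5`.
      have h4 : 1 / (2 * η') * ∑ i, lam (k + 1) i ^ 2 + ∑ i, -((lam k i + η' * g k i) * g (k + 1) i)
          ≤ 1 / (2 * η') * ∑ i, lam k i ^ 2 + η' / 2 * ∑ i, (g k i - g (k + 1) i) ^ 2
            + η' / 2 * ∑ i, g (k + 1) i ^ 2 - η' / 2 * ∑ i, g k i ^ 2 := by
        simp only [Finset.mul_sum]
        rw [← Finset.sum_add_distrib, ← Finset.sum_add_distrib, ← Finset.sum_add_distrib,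
          ← Finset.sum_sub_distrib]
        refine Finset.sum_le_sum fun i _ => ?_
        -- In the first branch of the maximum the discarded term is `(λ + η' g)²`, in the second
        -- `(η' g)²`.
        have h5 : lam (k + 1) i ^ 2 ≤
            lam k i ^ 2 + 2 * η' * (lam k i * g (k + 1) i) + 2 * (η' * g (k + 1) i) ^ 2 := by
          rw [hs]
          rcases max_choice (η' * -g (k + 1) i) (lam k i + η' * g (k + 1) i) with h | h <;> rw [h]
          · nlinarith [sq_nonneg (lam k i + η' * g (k + 1) i)]
          · nlinarith [sq_nonneg (η' * g (k + 1) i)]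
        have h6 := mul_le_mul_of_nonneg_left h5 (show 0 ≤ 1 / (2 * η') by positivity)
        have h7 : 1 / (2 * η') * (lam k i ^ 2 + 2 * η' * (lam k i * g (k + 1) i)
            + 2 * (η' * g (k + 1) i) ^ 2) = 1 / (2 * η') * lam k i ^ 2 + lam k i * g (k + 1) i
            + η' * g (k + 1) i ^ 2 := by
          field_simp
        rw [h7] at h6
        linarith
      rw [Finset.sum_neg_distrib] at h4
      rw [Finset.sum_range_succ]
      push_cast
      linarith
  have h1 := hind K le_rfl
  -- The choice of `λ_0` makes the initial potential nonnegative, so it can be dropped.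
  have h2 : 1 / (2 * η') * ∑ i, lam 0 i ^ 2 ≤ η' / 2 * ∑ i, g 0 i ^ 2 := by
    simp only [Finset.mul_sum]
    refine Finset.sum_le_sum fun i _ => ?_
    have h3 : lam 0 i ^ 2 ≤ (η' * g 0 i) ^ 2 := by
      rw [h0]
      rcases max_choice (η' * -g 0 i) 0 with h | h <;> rw [h]
      · exact le_of_eq (by ring)
      · nlinarith [sq_nonneg (η' * g 0 i)]
    have h4 := mul_le_mul_of_nonneg_left h3 (show 0 ≤ 1 / (2 * η') by positivity)
    have h5 : 1 / (2 * η') * (η' * g 0 i) ^ 2 = η' / 2 * g 0 i ^ 2 := by field_simp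
    rwa [h5] at h4
  linarith

theorem klVec_uniform_le {A : Type*} [Fintype A] [Nonempty A] {x : A → ℝ} (hx : ∀ a, 0 ≤ x a)
    (hx1 : ∑ a, x a = 1) :
    klVec x (fun _ => 1 / (Fintype.card A : ℝ)) ≤ Real.log (Fintype.card A : ℝ) := by
  have hc : (0 : ℝ) < Fintype.card A := Nat.cast_pos.2 Fintype.card_pos
  calc klVec x (fun _ => 1 / (Fintype.card A : ℝ)) ≤ ∑ a, x a * Real.log (Fintype.card A : ℝ) := by
        refine Finset.sum_le_sum fun a _ => ?_
        rcases (hx a).eq_or_lt with h0 | h0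
        · simp [← h0]
        refine mul_le_mul_of_nonneg_left (Real.log_le_log (by positivity) ?_) (hx a)
        have : x a ≤ 1 := hx1 ▸ Finset.single_le_sum (fun a _ => hx a) (Finset.mem_univ a)
        rw [div_div_eq_mul_div, div_one]
        exact mul_le_of_le_one_left hc.le this
    _ = Real.log (Fintype.card A : ℝ) := by rw [← Finset.sum_mul, hx1, one_mul]

/-! ### Lipschitz values and bounds on the ascent reward -/

namespace CMDP

variable {S A : Type*} [Fintype S] [Fintype A] {n : ℕ} (M : CMDP S A n) [DecidableEq S]

/-- The values are Lipschitz functions of the policy, with respect to the relative entropy. -/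
theorem sq_V_sub_le {π π' : S → A → ℝ} (hπ : IsPolicy π) (hπ' : IsPolicy π')
    (hpos : ∀ s a, 0 < π s a) (i : Fin (n + 1)) :
    (M.V π' i - M.V π i) ^ 2 ≤ 4 / (1 - M.γ) ^ 4 * M.visitKL π' π := by
  have hγ := M.one_sub_γ_pos
  set W := M.stateValue π (M.r i) with hW
  have hW0 : ∀ s, 0 ≤ W s := M.stateValue_nonneg hπ (hπ.sum_mul_nonneg (M.r_nonneg i))
  have hW1 : ∀ s, W s ≤ 1 / (1 - M.γ) := M.stateValue_le hπ (hπ.sum_mul_le (M.r_le_one i))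
  have hQ : ∀ s a, |M.r i s a + M.γ * M.next W s a| ≤ 1 / (1 - M.γ) := by
    intro s a
    have h0 : 0 ≤ M.next W s a :=
      Finset.sum_nonneg fun s' _ => mul_nonneg (M.P_nonneg s a s') (hW0 s')
    have h1 : M.next W s a ≤ 1 / (1 - M.γ) := by
      rw [← M.next_const (1 / (1 - M.γ)) s a]
      exact Finset.sum_le_sum fun s' _ => mul_le_mul_of_nonneg_left (hW1 s') (M.P_nonneg s a s')
    have h2 := mul_le_mul_of_nonneg_left h1 M.γ_pos.le
    rw [abs_of_nonneg (add_nonneg (M.r_nonneg i s a) (mul_nonneg M.γ_pos.le h0))]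
    have h3 : 1 / (1 - M.γ) = 1 + M.γ * (1 / (1 - M.γ)) := by field_simp; ring
    rw [h3]
    linarith [M.r_le_one i s a]
  have hdiff : ∀ s, |M.bellman π' (M.r i) W s - W s| ≤ 1 / (1 - M.γ) * ∑ a, |π' s a - π s a| := by
    intro s
    have : W s = M.bellman π (M.r i) W s := (congrFun (M.bellman_stateValue hπ (M.r i)) s).symm
    rw [this, bellman, bellman, ← Finset.sum_sub_distrib, Finset.mul_sum]
    refine (Finset.abs_sum_le_sum_abs _ _).trans (Finset.sum_le_sum fun a _ => ?_)
    rw [← sub_mul, abs_mul, mul_comm]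
    exact mul_le_mul_of_nonneg_right (hQ s a) (abs_nonneg _)
  set T : S → ℝ := fun s => ∑ a, |π' s a - π s a| with hT
  -- One factor `1 / (1 - γ)` bounds the Q-function, the other comes from the performance
  -- difference.
  have h1 : |M.V π' i - M.V π i| ≤ 1 / (1 - M.γ) ^ 2 * ∑ s, M.stateVisit π' s * T s := by
    have h := M.value_sub hπ' (M.r i) W
    have e : M.V π' i - M.V π i = M.value π' (M.r i) - ∑ s, M.ρ s * W s := rfl
    rw [e, h, abs_mul, abs_of_pos (one_div_pos.2 hγ)]
    calc 1 / (1 - M.γ) * |∑ s, M.stateVisit π' s * (M.bellman π' (M.r i) W s - W s)|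
        ≤ 1 / (1 - M.γ) * ∑ s, M.stateVisit π' s * (1 / (1 - M.γ) * T s) := by
          refine mul_le_mul_of_nonneg_left ((Finset.abs_sum_le_sum_abs _ _).trans
            (Finset.sum_le_sum fun s _ => ?_)) (one_div_pos.2 hγ).le
          rw [abs_mul, abs_of_nonneg (M.stateVisit_nonneg hπ' s)]
          exact mul_le_mul_of_nonneg_left (hdiff s) (M.stateVisit_nonneg hπ' s)
      _ = _ := by
          simp only [mul_left_comm _ (1 / (1 - M.γ)), ← Finset.mul_sum]
          rw [← mul_assoc]; congr 1; field_simp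
  -- Cauchy-Schwarz over states, then Pinsker in each state.
  have h2 : (∑ s, M.stateVisit π' s * T s) ^ 2 ≤ 4 * M.visitKL π' π := by
    have h := Finset.sum_sq_le_sum_mul_sum_of_sq_le_mul Finset.univ
      (r := fun s => M.stateVisit π' s * T s) (f := M.stateVisit π')
      (g := fun s => M.stateVisit π' s * T s ^ 2) (fun s _ => M.stateVisit_nonneg hπ' s)
      (fun s _ => mul_nonneg (M.stateVisit_nonneg hπ' s) (sq_nonneg _)) (fun s _ => le_of_eq (by ring))
    rw [M.sum_stateVisit hπ', one_mul] at h
    refine h.trans ?_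
    rw [visitKL, Finset.mul_sum]
    refine Finset.sum_le_sum fun s _ => ?_
    rw [mul_left_comm]
    exact mul_le_mul_of_nonneg_left (sq_sum_abs_sub_le_four_mul_klVec (hπ'.nonneg s)
      (hπ'.sum_eq_one s) (hpos s) (hπ.sum_eq_one s)) (M.stateVisit_nonneg hπ' s)
  calc (M.V π' i - M.V π i) ^ 2 = |M.V π' i - M.V π i| ^ 2 := (sq_abs _).symm
    _ ≤ (1 / (1 - M.γ) ^ 2 * ∑ s, M.stateVisit π' s * T s) ^ 2 :=
        pow_le_pow_left₀ (abs_nonneg _) h1 2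
    _ = 1 / (1 - M.γ) ^ 4 * (∑ s, M.stateVisit π' s * T s) ^ 2 := by
        rw [mul_pow, div_pow, one_pow, ← pow_mul]
    _ ≤ 1 / (1 - M.γ) ^ 4 * (4 * M.visitKL π' π) := mul_le_mul_of_nonneg_left h2 (by positivity)
    _ = _ := by ring

theorem visitKL_nonneg {π π' : S → A → ℝ} (hπ : IsPolicy π) (hπ' : IsPolicy π')
    (hpos : ∀ s a, 0 < π' s a) : 0 ≤ M.visitKL π π' :=
  Finset.sum_nonneg fun s _ => mul_nonneg (M.stateVisit_nonneg hπ s)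
    (klVec_nonneg (hπ.nonneg s) (hπ.sum_eq_one s) (hpos s) (hπ'.sum_eq_one s))

theorem visitKL_uniform_le [Nonempty A] {π : S → A → ℝ} (hπ : IsPolicy π) {ν : S → A → ℝ}
    (hν : ∀ s a, ν s a = 1 / (Fintype.card A : ℝ)) :
    M.visitKL π ν ≤ Real.log (Fintype.card A : ℝ) :=
  M.sum_stateVisit_mul_le hπ fun s _ => by
    rw [show ν s = fun _ => 1 / (Fintype.card A : ℝ) from funext (hν s)]
    exact klVec_uniform_le (hπ.nonneg s) (hπ.sum_eq_one s)

/-- The value of a linear combination of the rewards. -/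
theorem value_add_sum {π : S → A → ℝ} (hπ : IsPolicy π) (w : Fin n → ℝ) :
    M.value π (fun s a => M.r 0 s a + ∑ i, w i * M.r i.succ s a) =
      M.V π 0 + ∑ i, w i * M.V π i.succ := by
  have e : ∀ s, ∑ a, π s a * (M.r 0 s a + ∑ i, w i * M.r i.succ s a) =
      ∑ a, π s a * M.r 0 s a + ∑ i, w i * ∑ a, π s a * M.r i.succ s a := by
    intro s
    simp only [mul_add, Finset.sum_add_distrib, Finset.mul_sum]
    congr 1
    rw [Finset.sum_comm]
    exact Finset.sum_congr rfl fun i _ => Finset.sum_congr rfl fun a _ => by ring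
  simp only [V, M.value_eq_sum_stateVisit hπ, e]
  rw [← sub_eq_iff_eq_add', ← mul_sub, ← Finset.sum_sub_distrib]
  simp only [← mul_sub, add_sub_cancel_left]
  simp only [Finset.mul_sum (s := (Finset.univ : Finset (Fin n))),
    Finset.mul_sum (s := (Finset.univ : Finset S))]
  rw [Finset.sum_comm]
  exact Finset.sum_congr rfl fun i _ => Finset.sum_congr rfl fun s _ => by ring

theorem ascentReward_nonneg {η' : ℝ} {ν : S → A → ℝ} {lam : Fin n → ℝ}
    (hw : ∀ i, 0 ≤ lam i + η' * (M.b i - M.V ν i.succ)) (s : S) (a : A) :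
    0 ≤ M.ascentReward η' ν lam s a :=
  add_nonneg (M.r_nonneg 0 s a)
    (Finset.sum_nonneg fun i _ => mul_nonneg (hw i) (M.r_nonneg i.succ s a))

theorem ascentReward_le {η' : ℝ} (hη' : 0 ≤ η') {ν : S → A → ℝ} (hν : IsPolicy ν) {lam : Fin n → ℝ}
    (hw : ∀ i, 0 ≤ lam i + η' * (M.b i - M.V ν i.succ)) (s : S) (a : A) :
    M.ascentReward η' ν lam s a ≤ 1 + η' * (n : ℝ) / (1 - M.γ) + ∑ i, lam i := by
  have h : ∑ i, (lam i + η' * (M.b i - M.V ν i.succ)) * M.r i.succ s a ≤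
      ∑ i, (lam i + η' * (1 / (1 - M.γ))) := by
    refine Finset.sum_le_sum fun i _ => (mul_le_of_le_one_right (hw i) (M.r_le_one i.succ s a)).trans
      (add_le_add_right (mul_le_mul_of_nonneg_left ?_ hη') _)
    linarith [M.b_le i, M.V_nonneg hν i.succ]
  rw [Finset.sum_add_distrib, Finset.sum_const, Finset.card_univ, Fintype.card_fin,
    nsmul_eq_mul] at h
  have h1 : (n : ℝ) * (η' * (1 / (1 - M.γ))) = η' * (n : ℝ) / (1 - M.γ) := by ring
  rw [ascentReward]
  linarith [M.r_le_one 0 s a]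

end CMDP

/-- The number of inner iterations is large enough for the required accuracy. -/
theorem pow_sub_one_le_inv {γ x : ℝ} (hγ0 : 0 < γ) (hγ1 : γ < 1) (hx : 0 < x) {t : ℕ}
    (ht : 1 / (1 - γ) * Real.log x + 1 ≤ t) : γ ^ (t - 1) ≤ 1 / x := by
  have hγ : 0 < 1 - γ := sub_pos.2 hγ1
  have h1 : γ ≤ Real.exp (-(1 - γ)) := by linarith [Real.add_one_le_exp (-(1 - γ))]
  have h2 : (t : ℝ) ≤ ((t - 1 : ℕ) : ℝ) + 1 := by exact_mod_cast (by omega : t ≤ t - 1 + 1)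
  have h3 : Real.log x ≤ (1 - γ) * ((t - 1 : ℕ) : ℝ) := by
    have : 1 / (1 - γ) * Real.log x ≤ ((t - 1 : ℕ) : ℝ) := by linarith
    rwa [one_div, inv_mul_le_iff₀ hγ] at this
  calc γ ^ (t - 1) ≤ Real.exp (-(1 - γ)) ^ (t - 1) := pow_le_pow_left₀ hγ0.le h1 _
    _ = Real.exp (-((1 - γ) * ((t - 1 : ℕ) : ℝ))) := by rw [← Real.exp_nat_mul]; congr 1; ring
    _ ≤ Real.exp (-Real.log x) := Real.exp_le_exp.2 (neg_le_neg h3)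
    _ = 1 / x := by rw [Real.exp_neg, Real.exp_log hx, one_div]

/-! ### Dual variables, regret and constraint violation -/

namespace CMDP

variable {S A : Type*} [Fintype S] [DecidableEq S] [Fintype A] [DecidableEq A] {n : ℕ}
  (M : CMDP S A n)

section Dual

variable (θ₀ : S × A → ℝ) (η' α η : ℝ) (t : ℕ → ℕ)

/-- The constraint violations along ARNPG-EPD. -/
noncomputable def epdViolation (k : ℕ) (i : Fin n) : ℝ :=
  M.b i - M.V (M.epdPolicy θ₀ η' α η t k) i.succ

theorem epdDual_zero (i : Fin n) :
    M.epdDual θ₀ η' α η t 0 i = max (η' * -M.epdViolation θ₀ η' α η t 0 i) 0 := by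
  rw [epdViolation, neg_sub]; rfl

theorem epdDual_succ (k : ℕ) (i : Fin n) : M.epdDual θ₀ η' α η t (k + 1) i =
    max (η' * -M.epdViolation θ₀ η' α η t (k + 1) i)
      (M.epdDual θ₀ η' α η t k i + η' * M.epdViolation θ₀ η' α η t (k + 1) i) := by
  rw [epdViolation, neg_sub]; rfl

theorem epdDual_nonneg (k : ℕ) (i : Fin n) : 0 ≤ M.epdDual θ₀ η' α η t k i := by
  induction k with
  | zero => rw [epdDual_zero]; exact le_max_right _ _
  | succ k ih =>
    rw [epdDual_succ]
    rcases le_total 0 (η' * M.epdViolation θ₀ η' α η t (k + 1) i) with h | h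
    · exact le_max_of_le_right (add_nonneg ih h)
    · exact le_max_of_le_left (by linarith)

/-- The purpose of the first entry of the maximum: the ascent reward has nonnegative weights. -/
theorem epdDual_add_nonneg (k : ℕ) (i : Fin n) :
    0 ≤ M.epdDual θ₀ η' α η t k i + η' * M.epdViolation θ₀ η' α η t k i := by
  have h : η' * -M.epdViolation θ₀ η' α η t k i ≤ M.epdDual θ₀ η' α η t k i := by
    cases k with
    | zero => rw [epdDual_zero]; exact le_max_left _ _
    | succ k => rw [epdDual_succ]; exact le_max_left _ _
  linarith

/-- Both entries of the maximum bound `λ_k` below, by `-η' g_k` and by at least `η' g_k`; the second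
is unavailable at `k = 0`. -/
theorem sq_epdViolation_le_sq_epdDual {k : ℕ} (hk : 1 ≤ k) (i : Fin n) :
    (η' * M.epdViolation θ₀ η' α η t k i) ^ 2 ≤ M.epdDual θ₀ η' α η t k i ^ 2 := by
  obtain ⟨k, rfl⟩ := Nat.exists_eq_add_of_le' hk
  refine sq_le_sq.2 (le_trans ?_ (le_abs_self _))
  rw [abs_le']
  have h0 := M.epdDual_nonneg θ₀ η' α η t k i
  have h1 := M.epdDual_add_nonneg θ₀ η' α η t (k + 1) i
  have h2 : M.epdDual θ₀ η' α η t k i + η' * M.epdViolation θ₀ η' α η t (k + 1) i ≤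
      M.epdDual θ₀ η' α η t (k + 1) i := by
    rw [M.epdDual_succ θ₀ η' α η t k]; exact le_max_right _ _
  constructor <;> linarith

/-- The second entry of the maximum accumulates violations. -/
theorem sum_epdViolation_le (K : ℕ) (i : Fin n) :
    η' * ∑ k ∈ Finset.range K, M.epdViolation θ₀ η' α η t (k + 1) i ≤
      M.epdDual θ₀ η' α η t K i := by
  induction K with
  | zero => simpa using M.epdDual_nonneg θ₀ η' α η t 0 i
  | succ K ih =>
    rw [Finset.sum_range_succ, mul_add, epdDual_succ]
    exact le_max_of_le_right (by linarith)

end Dual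

theorem isPolicy_epdPolicy [Nonempty A] (θ₀ : S × A → ℝ) (η' α η : ℝ) (t : ℕ → ℕ) (k : ℕ) :
    IsPolicy (M.epdPolicy θ₀ η' α η t k) :=
  isPolicy_softmaxPolicy _

/-- One macro step of ARNPG-EPD compared with a feasible policy. -/
theorem V_sub_V_epdPolicy_succ_le [Nonempty A] {πs : S → A → ℝ} (hπs : IsPolicy πs)
    (hfeas : M.Feasible πs) (θ₀ : S × A → ℝ) {η' : ℝ} (hη' : 0 ≤ η') {α : ℝ} (hα : 0 < α)
    (t : ℕ → ℕ) (k : ℕ) :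
    M.V πs 0 - M.V (M.epdPolicy θ₀ η' α ((1 - M.γ) / α) t (k + 1)) 0 ≤
      -∑ i, (M.epdDual θ₀ η' α ((1 - M.γ) / α) t k i
          + η' * M.epdViolation θ₀ η' α ((1 - M.γ) / α) t k i)
          * M.epdViolation θ₀ η' α ((1 - M.γ) / α) t (k + 1) i
      - α * (M.visitKL (M.epdPolicy θ₀ η' α ((1 - M.γ) / α) t (k + 1))
          (M.epdPolicy θ₀ η' α ((1 - M.γ) / α) t k) / (1 - M.γ))
      + (α * (M.visitKL πs (M.epdPolicy θ₀ η' α ((1 - M.γ) / α) t k) / (1 - M.γ))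
        - α * (M.visitKL πs (M.epdPolicy θ₀ η' α ((1 - M.γ) / α) t (k + 1)) / (1 - M.γ)))
      + M.γ ^ (t k - 1) * ((1 + η' * (n : ℝ) / (1 - M.γ)
          + ∑ i, M.epdDual θ₀ η' α ((1 - M.γ) / α) t k i) / (1 - M.γ) ^ 2) := by
  have hw := M.epdDual_add_nonneg θ₀ η' α ((1 - M.γ) / α) t k
  have hk := M.isPolicy_epdPolicy θ₀ η' α ((1 - M.γ) / α) t k
  have hk1 := M.isPolicy_epdPolicy θ₀ η' α ((1 - M.γ) / α) t (k + 1)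
  set lam := M.epdDual θ₀ η' α ((1 - M.γ) / α) t k with hlam
  set B := 1 + η' * (n : ℝ) / (1 - M.γ) + ∑ i, lam i with hB
  have hr := M.ascentReward_le hη' hk hw
  have hr0 := M.ascentReward_nonneg (lam := lam) hw
  have hB0 : 0 ≤ B := add_nonneg (add_nonneg zero_le_one
    (div_nonneg (mul_nonneg hη' (Nat.cast_nonneg n)) M.one_sub_γ_pos.le))
    (Finset.sum_nonneg fun i _ => M.epdDual_nonneg θ₀ η' α ((1 - M.γ) / α) t k i)
  have h := M.value_sub_visitKL_add_visitKL_le hα hr0 hr (M.epd θ₀ η' α ((1 - M.γ) / α) t k).1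
    hB0 hπs (t k)
  change M.value πs (M.ascentReward η' (M.epdPolicy θ₀ η' α ((1 - M.γ) / α) t k) lam)
      - α * (M.visitKL πs (M.epdPolicy θ₀ η' α ((1 - M.γ) / α) t k) / (1 - M.γ))
      + α * (M.visitKL πs (M.epdPolicy θ₀ η' α ((1 - M.γ) / α) t (k + 1)) / (1 - M.γ)) ≤
      M.value (M.epdPolicy θ₀ η' α ((1 - M.γ) / α) t (k + 1))
        (M.ascentReward η' (M.epdPolicy θ₀ η' α ((1 - M.γ) / α) t k) lam)
      - α * (M.visitKL (M.epdPolicy θ₀ η' α ((1 - M.γ) / α) t (k + 1))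
        (M.epdPolicy θ₀ η' α ((1 - M.γ) / α) t k) / (1 - M.γ))
      + M.γ ^ (t k - 1) * (B / (1 - M.γ) ^ 2) at h
  have e : ∀ π, IsPolicy π →
      M.value π (M.ascentReward η' (M.epdPolicy θ₀ η' α ((1 - M.γ) / α) t k) lam) =
      M.V π 0 + ∑ i, (lam i + η' * M.epdViolation θ₀ η' α ((1 - M.γ) / α) t k i) * M.V π i.succ :=
    fun π hπ => M.value_add_sum hπ _
  rw [e _ hπs, e _ hk1] at h
  -- Nonnegative weights allow replacing the values of `πs` by the thresholds.
  have h1 : ∑ i, (lam i + η' * M.epdViolation θ₀ η' α ((1 - M.γ) / α) t k i) *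
      M.V (M.epdPolicy θ₀ η' α ((1 - M.γ) / α) t (k + 1)) i.succ -
      ∑ i, (lam i + η' * M.epdViolation θ₀ η' α ((1 - M.γ) / α) t k i) * M.V πs i.succ ≤
      -∑ i, (lam i + η' * M.epdViolation θ₀ η' α ((1 - M.γ) / α) t k i)
          * M.epdViolation θ₀ η' α ((1 - M.γ) / α) t (k + 1) i := by
    rw [← Finset.sum_sub_distrib, ← Finset.sum_neg_distrib]
    refine Finset.sum_le_sum fun i _ => ?_
    rw [← mul_sub, ← mul_neg]
    refine mul_le_mul_of_nonneg_left ?_ (hw i)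
    rw [epdViolation, neg_sub]
    exact sub_le_sub_left (hfeas i) _
  linarith

/-- The origin of the lower bound on `α`: `n` squares, each at most `4 / (1 - γ) ^ 4` times the
divergence. -/
theorem mul_sum_sq_epdViolation_sub_le [Nonempty A] (θ₀ : S × A → ℝ) {η' : ℝ} (hη' : 0 ≤ η') {α : ℝ}
    (hα : 2 * η' * ((n : ℝ) + 1) / (1 - M.γ) ^ 3 ≤ α) (η : ℝ) (t : ℕ → ℕ) (k : ℕ) :
    η' / 2 * ∑ i, (M.epdViolation θ₀ η' α η t k i - M.epdViolation θ₀ η' α η t (k + 1) i) ^ 2 ≤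
      α * (M.visitKL (M.epdPolicy θ₀ η' α η t (k + 1)) (M.epdPolicy θ₀ η' α η t k)
        / (1 - M.γ)) := by
  have hγ := M.one_sub_γ_pos
  have hk := M.isPolicy_epdPolicy θ₀ η' α η t k
  have hk1 := M.isPolicy_epdPolicy θ₀ η' α η t (k + 1)
  have hpos : ∀ s a, 0 < M.epdPolicy θ₀ η' α η t k s a := fun s a => softmaxPolicy_pos _ s a
  set D := M.visitKL (M.epdPolicy θ₀ η' α η t (k + 1)) (M.epdPolicy θ₀ η' α η t k) with hD
  have hD0 : 0 ≤ D := M.visitKL_nonneg hk1 hk hpos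
  calc η' / 2 * ∑ i, (M.epdViolation θ₀ η' α η t k i - M.epdViolation θ₀ η' α η t (k + 1) i) ^ 2
      ≤ η' / 2 * ∑ _i : Fin n, 4 / (1 - M.γ) ^ 4 * D := by
        refine mul_le_mul_of_nonneg_left (Finset.sum_le_sum fun i _ => ?_) (by positivity)
        rw [epdViolation, epdViolation, sub_sub_sub_cancel_left]
        exact M.sq_V_sub_le hk hk1 hpos i.succ
    _ = 2 * η' * (n : ℝ) / (1 - M.γ) ^ 3 * (D / (1 - M.γ)) := by
        rw [Finset.sum_const, Finset.card_univ, Fintype.card_fin, nsmul_eq_mul]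
        field_simp; ring
    _ ≤ α * (D / (1 - M.γ)) := by
        refine mul_le_mul_of_nonneg_right (le_trans ?_ hα) (div_nonneg hD0 hγ.le)
        gcongr
        linarith

/-- The argument of the logarithm cancels `L`; a factor `(1 - γ)² / 5` is spare. Truncating the
ceiling at 0 is harmless, since only `Nat.le_ceil` is used. -/
theorem pow_mul_div_le {γ η' N l K L : ℝ} (hγ0 : 0 < γ) (hγ1 : γ < 1) (hη' : 0 < η') (hN : 0 < N)
    (hl : 0 < l) (hK : 0 < K) (hL : 0 < L) {α : ℝ} (hα : 2 * η' * N / (1 - γ) ^ 3 ≤ α) {t : ℕ}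
    (ht : t = ⌈1 / (1 - γ) * Real.log (5 * L * K / (2 * η' * N * l)) + 1⌉₊) :
    γ ^ (t - 1) * (L / (1 - γ) ^ 2) ≤ α * l / (1 - γ) / K := by
  have hγ : 0 < 1 - γ := sub_pos.2 hγ1
  have h := pow_sub_one_le_inv hγ0 hγ1 (x := 5 * L * K / (2 * η' * N * l)) (by positivity)
    (t := t) (ht ▸ Nat.le_ceil _)
  calc γ ^ (t - 1) * (L / (1 - γ) ^ 2)
      ≤ 1 / (5 * L * K / (2 * η' * N * l)) * (L / (1 - γ) ^ 2) :=
        mul_le_mul_of_nonneg_right h (by positivity)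
    _ = (1 / 5 * (1 - γ) ^ 2) * (2 * η' * N / (1 - γ) ^ 3 * l / (1 - γ) / K) := by
        field_simp
    _ ≤ 1 * (2 * η' * N / (1 - γ) ^ 3 * l / (1 - γ) / K) := by
        refine mul_le_mul_of_nonneg_right ?_ (by positivity)
        nlinarith
    _ ≤ α * l / (1 - γ) / K := by
        rw [one_mul]
        gcongr

/-- The regret of ARNPG-EPD against a feasible policy. -/
theorem sum_V_sub_V_epdPolicy_le [Nontrivial A] {πs : S → A → ℝ} (hπs : IsPolicy πs)
    (hfeas : M.Feasible πs) {K : ℕ} (hK : 1 ≤ K) {η' : ℝ} (hη' : 0 < η') {θ₀ : S × A → ℝ}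
    (hθ₀ : ∀ s a, softmaxPolicy θ₀ s a = 1 / (Fintype.card A : ℝ)) {α : ℝ}
    (hα : 2 * η' * ((n : ℝ) + 1) / (1 - M.γ) ^ 3 ≤ α) {η : ℝ} (hη : η = (1 - M.γ) / α)
    {L : ℕ → ℝ} {t : ℕ → ℕ}
    (hL : ∀ k < K, L k = 1 + η' * (n : ℝ) / (1 - M.γ) + ∑ i, M.epdDual θ₀ η' α η t k i)
    (ht : ∀ k < K, t k = ⌈1 / (1 - M.γ) * Real.log (5 * L k * (K : ℝ) /
      (2 * η' * ((n : ℝ) + 1) * Real.log (Fintype.card A : ℝ))) + 1⌉₊) :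
    ∑ k ∈ Finset.range K, (M.V πs 0 - M.V (M.epdPolicy θ₀ η' α η t (k + 1)) 0) ≤
      η' / 2 * ∑ i, M.epdViolation θ₀ η' α η t K i ^ 2
        - 1 / (2 * η') * ∑ i, M.epdDual θ₀ η' α η t K i ^ 2
        + 2 * (α * Real.log (Fintype.card A : ℝ) / (1 - M.γ)) := by
  subst hη
  have hγ := M.one_sub_γ_pos
  have hα0 : 0 < α := lt_of_lt_of_le (by positivity) hα
  have hlog : 0 < Real.log (Fintype.card A : ℝ) :=
    Real.log_pos (by exact_mod_cast Fintype.one_lt_card)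
  have hK0 : (0 : ℝ) < K := by exact_mod_cast hK
  set l := Real.log (Fintype.card A : ℝ) with hl
  have h := sum_range_sub_le_of_drift hη' (M.epdDual_zero θ₀ η' α ((1 - M.γ) / α) t)
    (M.epdDual_succ θ₀ η' α ((1 - M.γ) / α) t)
    (v := fun k => M.V (M.epdPolicy θ₀ η' α ((1 - M.γ) / α) t k) 0)
    (D := fun k => α * (M.visitKL (M.epdPolicy θ₀ η' α ((1 - M.γ) / α) t (k + 1))
          (M.epdPolicy θ₀ η' α ((1 - M.γ) / α) t k) / (1 - M.γ)))
    (Φ := fun k => α * (M.visitKL πs (M.epdPolicy θ₀ η' α ((1 - M.γ) / α) t k) / (1 - M.γ)))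
    (vs := M.V πs 0) (e := α * l / (1 - M.γ) / K) (K := K)
    (fun k _ => M.mul_sum_sq_epdViolation_sub_le θ₀ hη'.le hα _ t k) (fun k hk => by
      refine (M.V_sub_V_epdPolicy_succ_le hπs hfeas θ₀ hη'.le hα0 t k).trans ?_
      have hLpos : 0 < L k := by
        rw [hL k hk]
        have := Finset.sum_nonneg fun i (_ : i ∈ Finset.univ) =>
          M.epdDual_nonneg θ₀ η' α ((1 - M.γ) / α) t k i
        positivity
      have h1 := pow_mul_div_le M.γ_pos M.γ_lt_one hη' (by positivity) hlog hK0 hLpos hα (ht k hk)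
      rw [← hL k hk]
      gcongr)
  -- The factor 2 collects the initial divergence, at most `log |A|` from uniform, and `K`
  -- inner-loop errors of relative size `1 / K`.
  have h1 : M.visitKL πs (M.epdPolicy θ₀ η' α ((1 - M.γ) / α) t 0) ≤ l :=
    M.visitKL_uniform_le hπs hθ₀
  have h2 : 0 ≤ M.visitKL πs (M.epdPolicy θ₀ η' α ((1 - M.γ) / α) t K) :=
    M.visitKL_nonneg hπs (isPolicy_softmaxPolicy _) fun s a => softmaxPolicy_pos _ s a
  have h3 : α * (M.visitKL πs (M.epdPolicy θ₀ η' α ((1 - M.γ) / α) t 0) / (1 - M.γ)) ≤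
      α * l / (1 - M.γ) := by
    rw [← mul_div_assoc]; gcongr
  have h4 : 0 ≤ α * (M.visitKL πs (M.epdPolicy θ₀ η' α ((1 - M.γ) / α) t K) / (1 - M.γ)) := by
    positivity
  have h5 : (K : ℝ) * (α * l / (1 - M.γ) / K) = α * l / (1 - M.γ) := mul_div_cancel₀ _ hK0.ne'
  rw [h5] at h
  linarith

/-- With a single action there is only one policy. -/
theorem _root_.IsPolicy.eq_one {S A : Type*} [Fintype A] [Subsingleton A] {π : S → A → ℝ}
    (hπ : IsPolicy π) (s : S) (a : A) : π s a = 1 := by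
  rw [← hπ.sum_eq_one s, Fintype.sum_subsingleton _ a]

/-- A dual certificate bounds the average optimality gap from below. -/
theorem neg_sum_mul_le_sum_V_sub [Nonempty A] {πs : S → A → ℝ} {lam : Fin n → ℝ}
    (hlam : ∀ i, 0 ≤ lam i) (hsaddle : ∀ π, IsPolicy π → M.lagrangian π lam ≤ M.V πs 0)
    (θ₀ : S × A → ℝ) {η' : ℝ} (hη' : 0 < η') (α η : ℝ) (t : ℕ → ℕ) (K : ℕ) :
    -(1 / η' * (√(∑ i, lam i ^ 2) * √(∑ i, M.epdDual θ₀ η' α η t K i ^ 2))) ≤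
      ∑ k ∈ Finset.range K, (M.V πs 0 - M.V (M.epdPolicy θ₀ η' α η t (k + 1)) 0) := by
  -- The saddle inequality at each iterate, summed over iterates.
  have h1 : -∑ i, lam i * ∑ k ∈ Finset.range K, M.epdViolation θ₀ η' α η t (k + 1) i ≤
      ∑ k ∈ Finset.range K, (M.V πs 0 - M.V (M.epdPolicy θ₀ η' α η t (k + 1)) 0) := by
    simp only [Finset.mul_sum]
    rw [Finset.sum_comm, ← Finset.sum_neg_distrib]
    refine Finset.sum_le_sum fun k _ => ?_
    have h := hsaddle _ (M.isPolicy_epdPolicy θ₀ η' α η t (k + 1))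
    have e : ∑ i, lam i * (M.V (M.epdPolicy θ₀ η' α η t (k + 1)) i.succ - M.b i) =
        -∑ i, lam i * M.epdViolation θ₀ η' α η t (k + 1) i := by
      rw [← Finset.sum_neg_distrib]
      exact Finset.sum_congr rfl fun i _ => by rw [epdViolation]; ring
    rw [lagrangian, e] at h
    linarith
  have h2 : ∑ i, lam i * ∑ k ∈ Finset.range K, M.epdViolation θ₀ η' α η t (k + 1) i ≤
      1 / η' * ∑ i, lam i * M.epdDual θ₀ η' α η t K i := by
    rw [Finset.mul_sum]
    refine Finset.sum_le_sum fun i _ => ?_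
    rw [mul_left_comm]
    refine mul_le_mul_of_nonneg_left ?_ (hlam i)
    rw [one_div_mul_eq_div, le_div_iff₀' hη']
    exact M.sum_epdViolation_le θ₀ η' α η t K i
  have h3 := mul_le_mul_of_nonneg_left (Real.sum_mul_le_sqrt_mul_sqrt Finset.univ lam
    (M.epdDual θ₀ η' α η t K)) (one_div_pos.2 hη').le
  linarith

/-- Violations are at most `1 / (1 - γ)` in absolute value, and at least two actions give `log |A| ≥
1/2`. -/
theorem mul_sum_sq_epdViolation_le [Nontrivial A] (θ₀ : S × A → ℝ) {η' : ℝ} (hη' : 0 < η') {α : ℝ}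
    (hα : 2 * η' * ((n : ℝ) + 1) / (1 - M.γ) ^ 3 ≤ α) (η : ℝ) (t : ℕ → ℕ) (k : ℕ) :
    η' / 2 * ∑ i, M.epdViolation θ₀ η' α η t k i ^ 2 ≤
      1 / 2 * (α * Real.log (Fintype.card A : ℝ) / (1 - M.γ)) := by
  have hγ := M.one_sub_γ_pos
  have hγ1 : 1 - M.γ ≤ 1 := by linarith [M.γ_pos]
  have hα0 : 0 < α := lt_of_lt_of_le (by positivity) hα
  have hlog : 1 / 2 ≤ Real.log (Fintype.card A : ℝ) := by
    have h2 : (2 : ℝ) ≤ Fintype.card A := by exact_mod_cast Fintype.one_lt_card (α := A)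
    linarith [Real.log_two_gt_d9, Real.log_le_log two_pos h2]
  have hk := M.isPolicy_epdPolicy θ₀ η' α η t k
  calc η' / 2 * ∑ i, M.epdViolation θ₀ η' α η t k i ^ 2
      ≤ η' / 2 * ∑ _i : Fin n, (1 / (1 - M.γ)) ^ 2 := by
        refine mul_le_mul_of_nonneg_left (Finset.sum_le_sum fun i _ => ?_) (by positivity)
        refine sq_le_sq' ?_ ?_
        · rw [epdViolation]; linarith [M.b_nonneg i, M.V_le hk i.succ]
        · rw [epdViolation]; linarith [M.b_le i, M.V_nonneg hk i.succ]
    _ = 1 / 4 * (1 - M.γ) ^ 2 * (2 * η' * (n : ℝ) / (1 - M.γ) ^ 3 / (1 - M.γ)) := by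
        rw [Finset.sum_const, Finset.card_univ, Fintype.card_fin, nsmul_eq_mul]
        field_simp; ring
    _ ≤ 1 / 4 * 1 * (α / (1 - M.γ)) := by
        gcongr
        · exact pow_le_one₀ hγ.le hγ1
        · refine le_trans ?_ hα
          gcongr
          linarith
    _ = 1 / 2 * (α * (1 / 2) / (1 - M.γ)) := by ring
    _ ≤ _ := by gcongr

end CMDP

/-- The larger root is `a + √(a² + 5c²) ≤ 2a + √5 c`. -/
theorem le_two_mul_add_three_mul {x a c : ℝ} (ha : 0 ≤ a) (hc : 0 ≤ c)
    (h : x ^ 2 - 2 * a * x ≤ 5 * c ^ 2) : x ≤ 2 * a + 3 * c := by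
  by_contra! hx
  have hx0 : 0 < x := by linarith
  nlinarith [mul_pos hx0 (sub_pos.2 hx), mul_nonneg hc ha, mul_nonneg hc hx0.le, mul_nonneg hc hc]

theorem sum_Icc_one_eq_sum_range {β : Type*} [AddCommMonoid β] (f : ℕ → β) (K : ℕ) :
    ∑ k ∈ Finset.Icc 1 K, f k = ∑ k ∈ Finset.range K, f (k + 1) := by
  induction K with
  | zero => simp
  | succ K ih => rw [Finset.sum_Icc_succ_top (by omega), ih, Finset.sum_range_succ]

theorem theorem2 {S A : Type*} [Fintype S] [DecidableEq S] [Fintype A] [DecidableEq A] {n : ℕ}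
    (M : CMDP S A n)
    -- an optimal policy and a (finite) optimal dual variable
    (πstar : S → A → ℝ) (hπstar : M.IsOptimal πstar)
    (lamstar : Fin n → ℝ) (hlamstar : M.IsDualOptimal lamstar)
    (K : ℕ) (hK : 1 ≤ K)
    (η' : ℝ) (hη'_pos : 0 < η') (hη'_le : η' ≤ 1)
    -- the initial policy is uniform
    (θ₀ : S × A → ℝ) (hθ₀ : ∀ s a, softmaxPolicy θ₀ s a = 1 / (Fintype.card A : ℝ))
    -- with `m = n + 1` reward functions
    (α : ℝ) (hα : 2 * η' * ((n : ℝ) + 1) / (1 - M.γ) ^ 3 ≤ α)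
    (η : ℝ) (hη : η = (1 - M.γ) / α)
    (L : ℕ → ℝ) (t : ℕ → ℕ)
    (hL : ∀ k < K, L k = 1 + η' * (n : ℝ) / (1 - M.γ) + ∑ i, M.epdDual θ₀ η' α η t k i)
    (ht : ∀ k < K, t k = ⌈1 / (1 - M.γ) * Real.log (5 * L k * (K : ℝ) /
      (2 * η' * ((n : ℝ) + 1) * Real.log (Fintype.card A : ℝ))) + 1⌉₊) :
    (M.V πstar 0 - 1 / (K : ℝ) * ∑ k ∈ Finset.Icc 1 K, M.V (M.epdPolicy θ₀ η' α η t k) 0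
      ≤ 3 * α * Real.log (Fintype.card A : ℝ) / ((1 - M.γ) * (K : ℝ))) ∧
    (∀ i : Fin n,
      M.b i - 1 / (K : ℝ) * ∑ k ∈ Finset.Icc 1 K, M.V (M.epdPolicy θ₀ η' α η t k) i.succ
        ≤ 1 / (K : ℝ) * (2 * Real.sqrt (∑ j, lamstar j ^ 2) / η'
          + 3 * Real.sqrt (α * Real.log (Fintype.card A : ℝ) / ((1 - M.γ) * η')))) := by
  have hγ := M.one_sub_γ_pos
  have hK0 : (0 : ℝ) < K := by exact_mod_cast hK
  have hα0 : 0 < α := lt_of_lt_of_le (by positivity) hα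
  have havg : ∀ (c : ℝ) (f : ℕ → ℝ), c - 1 / (K : ℝ) * ∑ k ∈ Finset.Icc 1 K, f k =
      1 / (K : ℝ) * ∑ k ∈ Finset.range K, (c - f (k + 1)) := by
    intro c f
    rw [sum_Icc_one_eq_sum_range, Finset.sum_sub_distrib, Finset.sum_const, Finset.card_range,
      nsmul_eq_mul]
    field_simp
  rw [havg]
  simp only [havg]
  obtain ⟨s₀, -, -⟩ : ∃ s ∈ Finset.univ, M.ρ s ≠ 0 :=
    Finset.exists_ne_zero_of_sum_ne_zero (by rw [M.ρ_sum]; exact one_ne_zero)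
  have hA : Nonempty A := by
    by_contra h
    rw [not_nonempty_iff] at h
    simpa using hπstar.isPolicy.sum_eq_one s₀
  rcases subsingleton_or_nontrivial A with hsub | hnt
  -- With one action every iterate equals the optimal policy, so the gap is zero and the constraints
  -- hold.
  · have heq : ∀ k, M.epdPolicy θ₀ η' α η t k = πstar := fun k => by
      funext s a
      rw [(M.isPolicy_epdPolicy θ₀ η' α η t k).eq_one, hπstar.isPolicy.eq_one]
    have hcard : Fintype.card A = 1 :=
      le_antisymm (Fintype.card_le_one_iff_subsingleton.2 hsub) Fintype.card_pos
    simp only [heq, hcard, Nat.cast_one, Real.log_one, mul_zero, zero_div, sub_self,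
      Finset.sum_const_zero, le_refl, true_and]
    intro i
    refine mul_le_mul_of_nonneg_left ?_ (one_div_pos.2 hK0).le
    exact (Finset.sum_nonpos fun k _ => sub_nonpos.2 (hπstar.feasible i)).trans (by positivity)
  · have hreg := M.sum_V_sub_V_epdPolicy_le hπstar.isPolicy hπstar.feasible hK hη'_pos hθ₀ hα hη
      hL ht
    set l := Real.log (Fintype.card A : ℝ) with hl
    have hlog : 0 < l := Real.log_pos (by exact_mod_cast Fintype.one_lt_card)
    constructor
    · have h1 : η' / 2 * ∑ i, M.epdViolation θ₀ η' α η t K i ^ 2 ≤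
          1 / (2 * η') * ∑ i, M.epdDual θ₀ η' α η t K i ^ 2 := by
        simp only [Finset.mul_sum]
        refine Finset.sum_le_sum fun i _ => ?_
        have h2 := mul_le_mul_of_nonneg_left
          (M.sq_epdViolation_le_sq_epdDual θ₀ η' α η t hK i)
          (show 0 ≤ 1 / (2 * η') by positivity)
        refine le_of_eq_of_le ?_ h2
        field_simp
      have h3 : 0 < α * l / (1 - M.γ) := by positivity
      calc 1 / (K : ℝ) * ∑ k ∈ Finset.range K,
            (M.V πstar 0 - M.V (M.epdPolicy θ₀ η' α η t (k + 1)) 0)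
          ≤ 1 / (K : ℝ) * (3 * (α * l / (1 - M.γ))) :=
            mul_le_mul_of_nonneg_left (by linarith) (one_div_pos.2 hK0).le
        _ = 3 * α * l / ((1 - M.γ) * K) := by field_simp
    · intro i
      have hlow := M.neg_sum_mul_le_sum_V_sub hlamstar.nonneg
        (fun π hπ => M.lagrangian_le_of_isDualOptimal hπstar hlamstar hπ) θ₀ hη'_pos α η t K
      have hviol := M.mul_sum_sq_epdViolation_le θ₀ hη'_pos hα η t K
      set a := √(∑ j, lamstar j ^ 2) with ha
      set x := √(∑ j, M.epdDual θ₀ η' α η t K j ^ 2) with hx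
      have hx2 : x ^ 2 = ∑ j, M.epdDual θ₀ η' α η t K j ^ 2 :=
        Real.sq_sqrt (Finset.sum_nonneg fun _ _ => sq_nonneg _)
      set c := √(α * l / ((1 - M.γ) * η')) with hc
      have hc2 : (η' * c) ^ 2 = η' * (α * l / (1 - M.γ)) := by
        rw [mul_pow, hc, Real.sq_sqrt (by positivity)]
        field_simp
      -- Lower and upper regret bounds meet here; the 5 is `2 * (2 + 1/2)`, with `1/2` from the
      -- final violations.
      have hbound : x ≤ 2 * a + 3 * (η' * c) := by
        refine le_two_mul_add_three_mul (Real.sqrt_nonneg _)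
          (mul_nonneg hη'_pos.le (Real.sqrt_nonneg _)) ?_
        rw [hc2]
        rw [← hx2] at hreg
        have h1 : 1 / (2 * η') * x ^ 2 - 1 / η' * (a * x) ≤ 5 / 2 * (α * l / (1 - M.γ)) := by
          linarith
        have h2 := mul_le_mul_of_nonneg_left h1 (show 0 ≤ 2 * η' by positivity)
        have h3 : 2 * η' * (1 / (2 * η') * x ^ 2 - 1 / η' * (a * x)) = x ^ 2 - 2 * a * x := by
          field_simp
        linarith
      have hxi : M.epdDual θ₀ η' α η t K i ≤ x :=
        Real.le_sqrt_of_sq_le (Finset.single_le_sum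
          (f := fun j => M.epdDual θ₀ η' α η t K j ^ 2) (fun _ _ => sq_nonneg _)
          (Finset.mem_univ i))
      have hsum := M.sum_epdViolation_le θ₀ η' α η t K i
      refine mul_le_mul_of_nonneg_left ?_ (one_div_pos.2 hK0).le
      have h4 : 2 * a / η' + 3 * c = (2 * a + 3 * (η' * c)) / η' := by field_simp
      rw [h4, le_div_iff₀' hη'_pos]
      exact hsum.trans (hxi.trans hbound)
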